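/- Let $\mathcal H\cong\mathbb C^N$ be a finite-dimensional Hilbert space, and let $\mathfrak g\subseteq\mathfrak u(\mathcal H)$ be a real Lie subalgebra of the skew-Hermitian operators that is simple, with a Cartan subalgebra $\mathfrak h\subseteq\mathfrak g$. Let $G=e^{\mathfrak g}\subseteq U(\mathcal H)$ be the compact group with Lie algebra $\mathfrak g$. Let $U(\theta)\in U(\mathcal H)$ be a random unitary (for instance, the unitary of a deep parametrized circuit with random parameters $\theta$, or a Haar random element of $G$) that forms a $2$-design over $G$, i.e. for all operators $A$ on $\mathcal H^{\otimes 2}$ $$\mathbb E_\theta\big[U(\theta)^{\otimes 2}A\,(U(\theta)^\dagger)^{\otimes 2}\big]=\int_G u^{\otimes 2}A\,(u^\dagger)^{\otimes 2}\,d\mu_{\mathrm{Haar}}(u).$$ For Hermitian $\rho$ and $O$ put $\ell_\theta(\rho,O)=\mathrm{Tr}[U(\theta)\rho\, U(\theta)^\dagger O]$. A weight basis is an orthonormal basis $\{|v\rangle\}$ of $\mathcal H$ with $H|v\rangle=\lambda_v(H)|v\rangle$ for all $H\in i\mathfrak h$, where $\lambda_v\in(i\mathfrak h)^*$ is the weight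 of $|v\rangle$. For $\lambda\in(i\mathfrak h)^*$ put $\|\lambda\|^2=\sum_j\lambda(H_j)^2$, where $\{H_j\}$ is any basis of $i\mathfrak h$ that is orthonormal for $\langle A,B\rangle=\mathrm{Tr}[A^\dagger B]$. Let $O\in i\mathfrak g$. (1) A matrix $\rho$ is a density matrix with $[\rho,\mathfrak h]=0$ (a weight state) if and only if $\rho=\sum_v r_v|v\rangle\langle v|$ for some weight basis $\{|v\rangle\}$ and some $r_v\ge 0$ with $\sum_v r_v=1$. For every such expression of $\rho$, $$\mathrm{Var}_\theta[\ell_\theta(\rho,O)]=\frac{\mathrm{Tr}[O^2]}{\dim\mathfrak g}\,\|\lambda_\rho\|^2,\qquad \lambda_\rho=\sum_v r_v\lambda_v .$$ (2) Suppose moreover that $\mathfrak g$ acts irreducibly on $\mathcal H$, and let $|hw\rangle$ be a highest weight unit vector with respect to some choice of positive roots of $(\mathfrak g_{\mathbb C},\mathfrak h_{\mathbb C})$, i.e. a weight vector annihilated by all positive root vectors. Then $|hw\rangle\langle hw|$ is a weight state, and among all weight states $\rho$ the variance $\mathrm{Var}_\theta[\ell_\theta(\rho,O)]$ is maximized at $\rho=|hw\rangle\langle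 hw|$. -/

import Mathlib

open MeasureTheory ProbabilityTheory
open scoped ComplexOrder

attribute [local instance] LieRing.ofAssociativeRing

namespace BarrenPlateau

variable {n : Type*} [Fintype n] [DecidableEq n]

/-! ### Subalgebras of `u(N)` and their Hermitian parts

The Hilbert space is `EuclideanSpace ℂ n`, operators on it are matrices `Matrix n n ℂ`. -/

/-- `𝔤 ⊆ 𝔲(N)`: every element is skew-Hermitian. -/
def IsSkewHermitianAlgebra (g : LieSubalgebra ℝ (Matrix n n ℂ)) : Prop :=
  ∀ X ∈ g, X.conjTranspose = -X

/-- For a real subspace `V` of matrices, the real subspace `iV`. -/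
def iMul (V : Submodule ℝ (Matrix n n ℂ)) : Submodule ℝ (Matrix n n ℂ) where
  carrier := {A | ∃ X ∈ V, A = Complex.I • X}
  add_mem' := by
    rintro _ _ ⟨X, hX, rfl⟩ ⟨Y, hY, rfl⟩
    exact ⟨X + Y, V.add_mem hX hY, (smul_add _ _ _).symm⟩
  zero_mem' := ⟨0, V.zero_mem, (smul_zero _).symm⟩
  smul_mem' := by
    rintro c _ ⟨X, hX, rfl⟩
    exact ⟨c • X, V.smul_mem c hX, (smul_comm _ _ _)⟩

/-- A subalgebra `𝔥` of `𝔤`, regarded as a real space of matrices. -/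
noncomputable def toMatrices {g : LieSubalgebra ℝ (Matrix n n ℂ)} (h : LieSubalgebra ℝ g) :
    Submodule ℝ (Matrix n n ℂ) :=
  h.toSubmodule.map g.toSubmodule.subtype

/-- The real space `i𝔥` of Hermitian matrices. -/
noncomputable abbrev iCartan {g : LieSubalgebra ℝ (Matrix n n ℂ)} (h : LieSubalgebra ℝ g) :
    Submodule ℝ (Matrix n n ℂ) :=
  iMul (toMatrices h)

/-- `𝔤` acts irreducibly on the Hilbert space: there is no proper nonzero invariant complex
subspace. -/
def ActsIrreducibly (g : LieSubalgebra ℝ (Matrix n n ℂ)) : Prop :=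
  ∀ W : Submodule ℂ (n → ℂ), (∀ X ∈ g, ∀ w ∈ W, X.mulVec w ∈ W) → W = ⊥ ∨ W = ⊤

/-! ### The group `G = e^𝔤`, its Haar measure, and designs -/

instance compactSpace_unitaryGroup : CompactSpace (Matrix.unitaryGroup n ℂ) := by
  apply isCompact_iff_compactSpace.mp
  have hb : IsCompact (Set.univ.pi fun _ : n => Set.univ.pi fun _ : n =>
      Metric.closedBall (0 : ℂ) 1) :=
    isCompact_univ_pi fun _ => isCompact_univ_pi fun _ => isCompact_closedBall _ _
  have hc : IsClosed ((Matrix.unitaryGroup n ℂ : Set (Matrix n n ℂ))) := by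
    have : (Matrix.unitaryGroup n ℂ : Set (Matrix n n ℂ)) =
        {A : Matrix n n ℂ | A * star A = 1} := by
      ext A
      exact Matrix.mem_unitaryGroup_iff
    rw [this]
    exact isClosed_eq (by fun_prop) continuous_const
  refine IsCompact.of_isClosed_subset hb hc ?_
  intro A hA i _ j _
  simpa using entry_norm_bound_of_unitary hA i j

/-- The Lie group `G = e^𝔤`: the closed subgroup of `U(N)` generated by the exponentials of the
elements of `𝔤`. (For simple `𝔤 ⊆ 𝔲(N)`, the connected subgroup with Lie algebra `𝔤` is compact and
equals `exp 𝔤`, so taking the closure does not add anything.) -/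
noncomputable def expGroup (g : LieSubalgebra ℝ (Matrix n n ℂ)) :
    Subgroup (Matrix.unitaryGroup n ℂ) :=
  (Subgroup.closure {u : Matrix.unitaryGroup n ℂ | ∃ X ∈ g, (u : Matrix n n ℂ) = NormedSpace.exp X}).topologicalClosure

instance compactSpace_expGroup (g : LieSubalgebra ℝ (Matrix n n ℂ)) :
    CompactSpace (expGroup g) :=
  isCompact_iff_compactSpace.mp (Subgroup.isClosed_topologicalClosure _).isCompact

noncomputable instance measurableSpaceExpGroup (g : LieSubalgebra ℝ (Matrix n n ℂ)) :
    MeasurableSpace (expGroup g) :=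
  borel _

instance borelSpace_expGroup (g : LieSubalgebra ℝ (Matrix n n ℂ)) :
    BorelSpace (expGroup g) :=
  ⟨rfl⟩

/-- The normalized Haar measure on `G = e^𝔤`. -/
noncomputable def haarG (g : LieSubalgebra ℝ (Matrix n n ℂ)) : Measure (expGroup g) :=
  Measure.haarMeasure ⊤

/-- The tensor power `A^{⊗ t}`, as a matrix indexed by `t`-tuples. -/
noncomputable def tensorPow (t : ℕ) (A : Matrix n n ℂ) : Matrix (Fin t → n) (Fin t → n) ℂ :=
  Matrix.of fun i j => ∏ k, A (i k) (j k)

/-- The `t`-th moment operator `A ↦ 𝔼_θ[U(θ)^{⊗ t} A (U(θ)^†)^{⊗ t}]` of a random unitary; the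
expectation is taken entrywise. -/
noncomputable def momentOperator {Θ : Type*} [MeasurableSpace Θ] (P : Measure Θ)
    (U : Θ → Matrix.unitaryGroup n ℂ) (t : ℕ)
    (A : Matrix (Fin t → n) (Fin t → n) ℂ) : Matrix (Fin t → n) (Fin t → n) ℂ :=
  Matrix.of fun i j => ∫ θ, (tensorPow t (U θ : Matrix n n ℂ) * A *
    tensorPow t (U θ : Matrix n n ℂ).conjTranspose) i j ∂P

/-- The random unitary `U(θ)`, `θ ∼ P`, forms a `t`-design over `G = e^𝔤`: its `t`-th moment
operator is that of the Haar measure on `G`. -/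
def IsDesign (g : LieSubalgebra ℝ (Matrix n n ℂ)) {Θ : Type*} [MeasurableSpace Θ]
    (P : Measure Θ) (U : Θ → Matrix.unitaryGroup n ℂ) (t : ℕ) : Prop :=
  momentOperator P U t = momentOperator (haarG g) (fun u => (u : Matrix.unitaryGroup n ℂ)) t

/-- The loss `Tr[U ρ U† O]`. For Hermitian `ρ` and `O` this trace is real; we take its real part in
order to have a real-valued function. -/
noncomputable def loss (ρ O : Matrix n n ℂ) (U : Matrix.unitaryGroup n ℂ) : ℝ :=
  ((U : Matrix n n ℂ) * ρ * (U : Matrix n n ℂ).conjTranspose * O).trace.re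

/-- The variance of the loss over the parameter landscape. -/
noncomputable def lossVariance {Θ : Type*} [MeasurableSpace Θ] (P : Measure Θ)
    (U : Θ → Matrix.unitaryGroup n ℂ) (ρ O : Matrix n n ℂ) : ℝ :=
  Var[fun θ => loss ρ O (U θ); P]

/-! ### Weights and weight states -/

/-- The operator `|v⟩⟨v|`. -/
noncomputable def ketbra (v : EuclideanSpace ℂ n) : Matrix n n ℂ :=
  Matrix.vecMulVec v.ofLp (star v.ofLp)

/-- `v` has weight `lam`, that is, `H v = lam(H) v` for all `H ∈ i𝔥`. -/
def HasWeight {g : LieSubalgebra ℝ (Matrix n n ℂ)} (h : LieSubalgebra ℝ g)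
    (lam : Module.Dual ℝ (iCartan h)) (v : EuclideanSpace ℂ n) : Prop :=
  ∀ H : iCartan h, (H : Matrix n n ℂ).mulVec v.ofLp = ((lam H : ℝ) : ℂ) • v.ofLp

/-- Density matrices `ρ` with `[ρ, 𝔥] = 0`. -/
def weightStates {g : LieSubalgebra ℝ (Matrix n n ℂ)} (h : LieSubalgebra ℝ g) :
    Set (Matrix n n ℂ) :=
  {ρ | ρ.PosSemidef ∧ ρ.trace = 1 ∧ ∀ X ∈ toMatrices h, ⁅ρ, X⁆ = 0}

/-- `ρ = ∑ r_v |v⟩⟨v|` is a convex combination of the pure states of an orthonormal weight basis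
`b`, whose vectors have the weights `lam`. -/
structure IsWeightDecomposition {g : LieSubalgebra ℝ (Matrix n n ℂ)} (h : LieSubalgebra ℝ g)
    (ρ : Matrix n n ℂ) (b : OrthonormalBasis n ℂ (EuclideanSpace ℂ n))
    (lam : n → Module.Dual ℝ (iCartan h)) (r : n → ℝ) : Prop where
  weight : ∀ v, HasWeight h (lam v) (b v)
  nonneg : ∀ v, 0 ≤ r v
  sum_eq_one : ∑ v, r v = 1
  eq_sum : ρ = ∑ v, (r v : ℂ) • ketbra (b v)

/-- The basis `B` of `i𝔥` is orthonormal for the Hilbert–Schmidt inner product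
`⟨A, B⟩ = Tr[A† B]`. -/
def IsHSOrthonormal {g : LieSubalgebra ℝ (Matrix n n ℂ)} {h : LieSubalgebra ℝ g} {d : ℕ}
    (B : Module.Basis (Fin d) ℝ (iCartan h)) : Prop :=
  ∀ i j, ((B i : Matrix n n ℂ).conjTranspose * (B j : Matrix n n ℂ)).trace =
    if i = j then 1 else 0

/-- `‖lam‖² = ∑_j lam(H_j)²` for a basis `(H_j)` of `i𝔥`, which is meant to be orthonormal. -/
noncomputable def weightNormSq {g : LieSubalgebra ℝ (Matrix n n ℂ)} {h : LieSubalgebra ℝ g} {d : ℕ}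
    (B : Module.Basis (Fin d) ℝ (iCartan h)) (lam : Module.Dual ℝ (iCartan h)) : ℝ :=
  ∑ j, lam (B j) ^ 2

/-! ### Roots, positive systems and highest weight vectors -/

/-- `E` is a root vector of `𝔤_ℂ = span_ℂ 𝔤` for the root `α`. -/
structure IsRootVector {g : LieSubalgebra ℝ (Matrix n n ℂ)} (h : LieSubalgebra ℝ g)
    (α : Module.Dual ℝ (iCartan h)) (E : Matrix n n ℂ) : Prop where
  mem : E ∈ Submodule.span ℂ (g : Set (Matrix n n ℂ))
  vec_ne_zero : E ≠ 0
  root_ne_zero : α ≠ 0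
  bracket : ∀ H : iCartan h, ⁅(H : Matrix n n ℂ), E⁆ = ((α H : ℝ) : ℂ) • E

/-- `H₀ ∈ i𝔥` is regular: no root vanishes on it. A regular element determines the system of
positive roots `{α | 0 < α(H₀)}`, and every system of positive roots is of this form. -/
def IsRegularElement {g : LieSubalgebra ℝ (Matrix n n ℂ)} {h : LieSubalgebra ℝ g}
    (H₀ : iCartan h) : Prop :=
  ∀ α E, IsRootVector h α E → α H₀ ≠ 0

/-- The unit vector `v` is a highest weight vector with respect to the positive roots determined by
`H₀`: it is a weight vector annihilated by all positive root vectors. -/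
structure IsHighestWeightVector {g : LieSubalgebra ℝ (Matrix n n ℂ)} {h : LieSubalgebra ℝ g}
    (H₀ : iCartan h) (v : EuclideanSpace ℂ n) : Prop where
  norm_eq_one : ‖v‖ = 1
  weight : ∃ lam, HasWeight h lam v
  annihilated : ∀ α E, IsRootVector h α E → 0 < α H₀ → E.mulVec v.ofLp = 0

end BarrenPlateau

open BarrenPlateau

/-! The loss sees `ρ` only through its orthogonal projection `p` to `i𝔤`: for `u ∈ G` it equals `⟨u
p u†, O⟩`. Simplicity of `𝔤` makes `i𝔤` an irreducible real representation of `G` under conjugation.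
Hence the mean, an invariant functional, vanishes (`integral_lossFunctional`), and the second
moment, an invariant symmetric form, is `k` times the Hilbert–Schmidt product
(`exists_eq_mul_inner_of_invariant`). Parseval gives `k dim 𝔤 = ‖p‖²`, so the variance is `Tr[O²]
‖p‖² / dim 𝔤` (`lossVariance_haarG`). A 2-design has the same first two moments of the loss
(`lossVariance_eq_haarG`).

If `ρ` commutes with `𝔥`, so does `p`; a Cartan subalgebra contains its centralizer, so `p ∈ i𝔥`
(`projection_mem_iCartan`). There `p` represents `H ↦ Tr[ρH]`, which is `λ_ρ`, and `‖p‖² = ‖λ_ρ‖²`.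
Weight decompositions come from diagonalizing `ρ` together with the commuting family `i𝔥`.

For the maximum, convexity of the squared norm leaves the claim that no weight is longer than the
highest one. Instead of the Weyl group, the proof takes, among the longest weights, one of greatest
height `μ(H₀)`. If a positive root vector did not kill its weight vector, the root string would
reach the mirror image of `μ`, which is as long and higher (`mulVec_eq_zero_of_maximal`). So `μ` is
a highest weight, and an irreducible representation has only one (`HasWeight.eq_of_annihilated`). -/

namespace BarrenPlateau

set_option linter.unusedSectionVars false

/-! ### Joint diagonalization and Schur's lemma -/

section

open Module.End in
/-- A commuting family of operators that are symmetric for some inner product is simultaneously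
diagonalizable. -/
theorem iSup_iInf_eigenspace_eq_top {E ι : Type*} [AddCommGroup E] [Module ℂ E]
    [FiniteDimensional ℂ E] (c : InnerProductSpace.Core ℂ E) (T : ι → Module.End ℂ E)
    (hT : ∀ i x y, c.inner (T i x) y = c.inner x (T i y)) (hc : ∀ i j, Commute (T i) (T j)) :
    ⨆ χ : ι → ℂ, ⨅ i, eigenspace (T i) (χ i) = ⊤ := by
  let : NormedAddCommGroup E := c.toNormedAddCommGroup
  let : InnerProductSpace ℂ E := InnerProductSpace.ofCore c.toCore
  exact LinearMap.IsSymmetric.iSup_iInf_eq_top_of_commute (T := T) (fun i x y => hT i x y)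
    fun i j _ => hc i j

open Module.End in
/-- Commuting Hermitian matrices have an orthonormal basis of joint eigenvectors. -/
theorem exists_orthonormalBasis_joint_eigenvectors {n ι : Type*} [Fintype n] [DecidableEq n]
    (A : ι → Matrix n n ℂ) (hA : ∀ i, (A i).IsHermitian) (hc : ∀ i j, Commute (A i) (A j)) :
    ∃ (b : OrthonormalBasis n ℂ (EuclideanSpace ℂ n)) (χ : n → ι → ℂ),
      ∀ v i, (A i).mulVec (b v).ofLp = χ v i • (b v).ofLp := by
  classical
  set T : ι → Module.End ℂ (EuclideanSpace ℂ n) := fun i => Matrix.toEuclideanLin (A i) with hTdef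
  have hT : ∀ i, (T i).IsSymmetric := fun i => Matrix.isSymmetric_toEuclideanLin_iff.2 (hA i)
  have hcT : ∀ i j, Commute (T i) (T j) := by
    intro i j
    ext x : 1
    have := congrArg (fun M => M.mulVec x.ofLp) (hc i j).eq
    simp only [← Matrix.mulVec_mulVec] at this
    simp only [hTdef, Module.End.mul_apply]
    ext k
    exact congrFun this k
  have htop := LinearMap.IsSymmetric.iSup_iInf_eq_top_of_commute hT fun i j _ => hcT i j
  have hfam := LinearMap.IsSymmetric.orthogonalFamily_iInf_eigenspaces hT
  set V : (ι → ℂ) → Submodule ℂ (EuclideanSpace ℂ n) := fun χ => ⨅ i, eigenspace (T i) (χ i)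
    with hV
  have hon := hfam.orthonormal_sigma_orthonormal
    (v_family := fun χ => stdOrthonormalBasis ℂ (V χ)) fun χ => (stdOrthonormalBasis ℂ (V χ)).orthonormal
  set u : (Σ χ, Fin (Module.finrank ℂ (V χ))) → EuclideanSpace ℂ n :=
    fun a => (V a.1).subtypeₗᵢ (stdOrthonormalBasis ℂ (V a.1) a.2) with hu
  -- The index runs over all functions `χ`, but almost all joint eigenspaces are zero: an
  -- orthonormal family in finite dimension is finite.
  have : Finite (Σ χ, Fin (Module.finrank ℂ (V χ))) := hon.linearIndependent.finite
  have := Fintype.ofFinite (Σ χ, Fin (Module.finrank ℂ (V χ)))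
  have hspan : ⊤ ≤ Submodule.span ℂ (Set.range u) := by
    rw [← htop]
    refine iSup_le fun χ => ?_
    intro x hx
    have hx' := (stdOrthonormalBasis ℂ (V χ)).sum_repr ⟨x, hx⟩
    have hx2 := congrArg (V χ).subtype hx'
    simp only [map_sum, map_smul, Submodule.subtype_apply] at hx2
    rw [← hx2]
    exact Submodule.sum_mem _ fun j _ => Submodule.smul_mem _ _
      (Submodule.subset_span ⟨⟨χ, j⟩, rfl⟩)
  let b₀ := OrthonormalBasis.mk hon hspan
  have hcard : Fintype.card (Σ χ, Fin (Module.finrank ℂ (V χ))) = Fintype.card n := by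
    rw [← Module.finrank_eq_card_basis b₀.toBasis, finrank_euclideanSpace]
  let e := Fintype.equivOfCardEq hcard
  refine ⟨b₀.reindex e, fun v => (e.symm v).1, fun v i => ?_⟩
  have hmem : u (e.symm v) ∈ V (e.symm v).1 := Submodule.coe_mem _
  have := (Submodule.mem_iInf _).1 hmem i
  rw [mem_eigenspace_iff] at this
  have h2 : (b₀.reindex e) v = u (e.symm v) := by simp [b₀, OrthonormalBasis.reindex_apply, OrthonormalBasis.coe_mk, hu]
  rw [h2]
  exact congrArg WithLp.ofLp this

/-- Schur's lemma for symmetric bilinear forms: two invariant symmetric forms on an irreducible real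
representation are proportional, if one of them is an inner product. -/
theorem exists_eq_mul_inner_of_invariant {W G : Type*} [AddCommGroup W] [Module ℝ W]
    [FiniteDimensional ℝ W] [Nontrivial W] (c : InnerProductSpace.Core ℝ W)
    (Q : W →ₗ[ℝ] W →ₗ[ℝ] ℝ) (hQ : ∀ a b, Q a b = Q b a) (π π' : G → W → W)
    (hπ : ∀ g a, π g (π' g a) = a)
    (hirr : ∀ K : Submodule ℝ W, (∀ g, ∀ a ∈ K, π g a ∈ K) → K = ⊥ ∨ K = ⊤)
    (hQπ : ∀ g a b, Q (π g a) (π g b) = Q a b)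
    (hcπ : ∀ g a b, c.inner (π g a) (π g b) = c.inner a b) :
    ∃ k : ℝ, ∀ a b, Q a b = k * c.inner a b := by
  let : NormedAddCommGroup W := c.toNormedAddCommGroup
  let : InnerProductSpace ℝ W := InnerProductSpace.ofCore c.toCore
  let e := stdOrthonormalBasis ℝ W
  -- `T` represents `Q` with respect to the inner product: `Q a b = ⟨T a, b⟩`. Being symmetric, it
  -- has a real eigenvalue `k`.
  let T : W →ₗ[ℝ] W := ∑ i, (Q.flip (e i)).smulRight (e i)
  have hT : ∀ a b, inner ℝ (T a) b = Q a b := by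
    intro a b
    conv_rhs => rw [← e.sum_repr' b]
    simp only [T, LinearMap.sum_apply, LinearMap.smulRight_apply, LinearMap.flip_apply, sum_inner,
      map_sum, map_smul, inner_smul_left, smul_eq_mul, RCLike.conj_to_real]
    exact Finset.sum_congr rfl fun i _ => mul_comm _ _
  have hsymm : T.IsSymmetric := fun a b => by
    rw [hT, hQ, ← hT, real_inner_comm]
  obtain ⟨k, hk⟩ : ∃ k, Module.End.HasEigenvalue T k := by
    by_contra! hno
    exact not_subsingleton W (hsymm.subsingleton_of_no_eigenvalue_finiteDimensional
      fun μ => not_not.1 fun h => hno μ h)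
  obtain ⟨v, hv⟩ := hk.exists_hasEigenvector
  have hker : ∀ a, T a = k • a ↔ ∀ b, Q a b = k * c.inner a b := by
    intro a
    have h1 : ∀ b, k * c.inner a b = inner ℝ (k • a) b := fun b => by
      rw [inner_smul_left, RCLike.conj_to_real]
    constructor
    · intro h b
      rw [← hT, h, h1]
    · intro h
      refine ext_inner_right ℝ fun b => ?_
      rw [hT, h, h1]
  -- By `hker` the eigenspace is described by the two invariant forms alone, so it is stable under
  -- each `π g`, and linearity of `π g` is not needed.
  rcases hirr (Module.End.eigenspace T k) (by
    intro g a ha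
    rw [Module.End.mem_eigenspace_iff, hker] at ha ⊢
    intro b
    rw [← hπ g b, hQπ, hcπ, ha]) with h | h
  · exact absurd h hk
  · refine ⟨k, fun a => (hker a).1 ?_⟩
    rw [← Module.End.mem_eigenspace_iff, h]
    trivial

end

section

variable {n : Type*} [Fintype n] [DecidableEq n]

/-! ### Hilbert–Schmidt inner products -/

theorem trace_conjTranspose_mul_self_eq_ofReal (A : Matrix n n ℂ) :
    (A.conjTranspose * A).trace = ((∑ i, ∑ j, ‖A j i‖ ^ 2 : ℝ) : ℂ) := by
  simp only [Matrix.trace, Matrix.diag_apply, Matrix.mul_apply, Matrix.conjTranspose_apply]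
  push_cast
  exact Finset.sum_congr rfl fun i _ => Finset.sum_congr rfl fun j _ => RCLike.conj_mul _

theorem trace_conjTranspose_mul_self_re_nonneg (A : Matrix n n ℂ) :
    0 ≤ (A.conjTranspose * A).trace.re := by
  rw [trace_conjTranspose_mul_self_eq_ofReal, Complex.ofReal_re]
  positivity

theorem eq_zero_of_trace_conjTranspose_mul_self_re {A : Matrix n n ℂ}
    (h : (A.conjTranspose * A).trace.re = 0) : A = 0 := by
  rw [← Matrix.trace_conjTranspose_mul_self_eq_zero_iff, trace_conjTranspose_mul_self_eq_ofReal] at *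
  rw [Complex.ofReal_re] at h
  rw [h, Complex.ofReal_zero]

theorem trace_conjTranspose_mul_conj (A B : Matrix n n ℂ) :
    star (A.conjTranspose * B).trace = (B.conjTranspose * A).trace := by
  rw [← Matrix.trace_conjTranspose, Matrix.conjTranspose_mul, Matrix.conjTranspose_conjTranspose]

/-- The Hilbert–Schmidt inner product on a complex space of matrices. -/
@[reducible]
noncomputable def hsCore (S : Submodule ℂ (Matrix n n ℂ)) : InnerProductSpace.Core ℂ S where
  inner A B := ((A : Matrix n n ℂ).conjTranspose * (B : Matrix n n ℂ)).trace
  conj_inner_symm A B := trace_conjTranspose_mul_conj _ _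
  re_inner_nonneg A := trace_conjTranspose_mul_self_re_nonneg _
  add_left A B C := by
    simp [Matrix.conjTranspose_add, add_mul]
  smul_left A B c := by
    simp [Matrix.conjTranspose_smul]
  definite A hA := by
    exact Subtype.ext (Matrix.trace_conjTranspose_mul_self_eq_zero_iff.1 hA)

/-- The real Hilbert–Schmidt inner product on a real space of matrices. -/
@[reducible]
noncomputable def hsCoreReal (S : Submodule ℝ (Matrix n n ℂ)) : InnerProductSpace.Core ℝ S where
  inner A B := ((A : Matrix n n ℂ).conjTranspose * (B : Matrix n n ℂ)).trace.re
  conj_inner_symm A B := by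
    rw [← trace_conjTranspose_mul_conj]
    simp
  re_inner_nonneg A := trace_conjTranspose_mul_self_re_nonneg _
  add_left A B C := by
    simp [Matrix.conjTranspose_add, add_mul]
  smul_left A B c := by
    simp [Matrix.conjTranspose_smul]
  definite A hA := by
    exact Subtype.ext (eq_zero_of_trace_conjTranspose_mul_self_re hA)

/-! ### Structure of `𝔤` -/

theorem isHermitian_of_mem_iMul {g : LieSubalgebra ℝ (Matrix n n ℂ)} (hg : IsSkewHermitianAlgebra g)
    {A : Matrix n n ℂ} (hA : A ∈ iMul g.toSubmodule) : A.IsHermitian := by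
  obtain ⟨X, hX, rfl⟩ := hA
  rw [Matrix.IsHermitian, Matrix.conjTranspose_smul, hg X hX]
  simp

theorem toMatrices_le {g : LieSubalgebra ℝ (Matrix n n ℂ)} (h : LieSubalgebra ℝ g) :
    toMatrices h ≤ g.toSubmodule := by
  rintro _ ⟨x, _, rfl⟩
  exact x.2

theorem iMul_mono {V W : Submodule ℝ (Matrix n n ℂ)} (h : V ≤ W) : iMul V ≤ iMul W := by
  rintro _ ⟨X, hX, rfl⟩
  exact ⟨X, h hX, rfl⟩

theorem iCartan_le {g : LieSubalgebra ℝ (Matrix n n ℂ)} (h : LieSubalgebra ℝ g) :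
    iCartan h ≤ iMul g.toSubmodule :=
  iMul_mono (toMatrices_le h)

theorem I_smul_mem_iMul {V : Submodule ℝ (Matrix n n ℂ)} {X : Matrix n n ℂ} (hX : X ∈ V) :
    Complex.I • X ∈ iMul V :=
  ⟨X, hX, rfl⟩

/-- A skew-Hermitian matrix whose commutator with `X` commutes with `X` commutes with `X`. -/
theorem commute_of_commute_bracket {X Z : Matrix n n ℂ} (hX : X.conjTranspose = -X)
    (hZ : Z.conjTranspose = -Z) (h : ⁅X, ⁅X, Z⁆⁆ = 0) : ⁅X, Z⁆ = 0 := by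
  set D := ⁅X, Z⁆ with hD
  have hD' : D = X * Z - Z * X := Ring.lie_def X Z
  have hDs : D.conjTranspose = -D := by
    rw [hD', Matrix.conjTranspose_sub, Matrix.conjTranspose_mul, Matrix.conjTranspose_mul, hX, hZ]
    simp
  rw [Ring.lie_def, sub_eq_zero] at h
  -- `Tr[D†D] = -Tr[D(XZ - ZX)]`, which vanishes by cyclicity because `D` commutes with `X`.
  refine Matrix.trace_conjTranspose_mul_self_eq_zero_iff.1 ?_
  rw [hDs, neg_mul, Matrix.trace_neg, neg_eq_zero]
  nth_rw 2 [hD']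
  rw [mul_sub, Matrix.trace_sub, ← mul_assoc, ← h, mul_assoc X, Matrix.trace_mul_comm X,
    mul_assoc, sub_self]

variable {g : LieSubalgebra ℝ (Matrix n n ℂ)} {h : LieSubalgebra ℝ g}

/-- A Cartan subalgebra is nilpotent, so `ad x` is nilpotent on it. For skew-Hermitian matrices `ad
x` and `(ad x)²` have the same kernel, so nilpotency forces `ad x = 0`. -/
theorem lie_eq_zero_of_mem_cartan (hg : IsSkewHermitianAlgebra g) (hh : h.IsCartanSubalgebra)
    (x y : h) : ⁅x, y⁆ = 0 := by
  have hnil := LieModule.isNilpotent_toEnd_of_isNilpotent ℝ h h x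
  obtain ⟨k, hk⟩ := hnil
  have key : ∀ (k : ℕ) (z : h), ((LieModule.toEnd ℝ h h x) ^ (k + 1)) z = 0 → ⁅x, z⁆ = 0 := by
    intro k
    induction k with
    | zero => intro z hz; simpa using hz
    | succ k ih =>
      intro z hz
      rw [pow_succ, Module.End.mul_apply] at hz
      have h2 := ih _ hz
      rw [LieModule.toEnd_apply_apply] at h2
      have h3 : ⁅((x : g) : Matrix n n ℂ), ⁅((x : g) : Matrix n n ℂ), ((z : g) : Matrix n n ℂ)⁆⁆ = 0 := by
        have := congrArg (fun w : h => ((w : g) : Matrix n n ℂ)) h2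
        simpa using this
      have h4 := commute_of_commute_bracket (hg _ (x : g).2) (hg _ (z : g).2) h3
      apply Subtype.ext
      apply Subtype.ext
      simpa using h4
  refine key k y ?_
  rw [pow_succ', hk, mul_zero, LinearMap.zero_apply]

theorem commute_of_mem_iCartan (hg : IsSkewHermitianAlgebra g) (hh : h.IsCartanSubalgebra)
    {A B : Matrix n n ℂ} (hA : A ∈ iCartan h) (hB : B ∈ iCartan h) : Commute A B := by
  obtain ⟨_, ⟨x, hx, rfl⟩, rfl⟩ := hA
  obtain ⟨_, ⟨y, hy, rfl⟩, rfl⟩ := hB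
  have h1 := lie_eq_zero_of_mem_cartan hg hh ⟨x, hx⟩ ⟨y, hy⟩
  have h2 : ⁅(x : Matrix n n ℂ), (y : Matrix n n ℂ)⁆ = 0 := by
    have := congrArg (fun w : h => ((w : g) : Matrix n n ℂ)) h1
    simpa using this
  rw [Ring.lie_def, sub_eq_zero] at h2
  exact Commute.smul_left (Commute.smul_right h2 _) _

/-- A Cartan subalgebra contains its centralizer. -/
theorem mem_iCartan_of_commute (hh : h.IsCartanSubalgebra) {A : Matrix n n ℂ}
    (hA : A ∈ iMul g.toSubmodule) (hc : ∀ H ∈ iCartan h, Commute A H) : A ∈ iCartan h := by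
  obtain ⟨X, hX, rfl⟩ := hA
  refine I_smul_mem_iMul ?_
  refine ⟨⟨X, hX⟩, ?_, rfl⟩
  change (⟨X, hX⟩ : g) ∈ h
  -- An element that centralizes `𝔥` normalizes it, and `𝔥` is its own normalizer.
  rw [← hh.self_normalizing, LieSubalgebra.mem_normalizer_iff]
  intro y hy
  have h1 : Commute (Complex.I • X) (Complex.I • (y : Matrix n n ℂ)) :=
    hc _ (I_smul_mem_iMul ⟨y, hy, rfl⟩)
  have h2 : X * (y : Matrix n n ℂ) - (y : Matrix n n ℂ) * X = 0 := by
    have := h1.eq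
    simp only [smul_mul_smul_comm, Complex.I_mul_I, neg_one_smul, neg_inj] at this
    rw [this, sub_self]
  have h3 : ⁅(⟨X, hX⟩ : g), y⁆ = 0 := by
    apply Subtype.ext
    rw [LieSubalgebra.coe_bracket]
    exact h2
  rw [h3]
  exact h.zero_mem

/-! ### The complexification of `𝔤` -/

variable (g) in
/-- The complexification `𝔤_ℂ = 𝔤 + i𝔤`. -/
abbrev complexSpan : Submodule ℂ (Matrix n n ℂ) :=
  Submodule.span ℂ (g : Set (Matrix n n ℂ))

theorem mem_complexSpan_of_mem_iMul {A : Matrix n n ℂ} (hA : A ∈ iMul g.toSubmodule) :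
    A ∈ complexSpan g := by
  obtain ⟨X, hX, rfl⟩ := hA
  exact Submodule.smul_mem _ _ (Submodule.subset_span hX)

/-- For skew-Hermitian `𝔤` this is the splitting into Hermitian and skew-Hermitian parts; it reduces
questions about `𝔤_ℂ` to `i𝔤`. -/
theorem exists_eq_add_of_mem_complexSpan {X : Matrix n n ℂ} (hX : X ∈ complexSpan g) :
    ∃ A ∈ iMul g.toSubmodule, ∃ B ∈ iMul g.toSubmodule, X = A + Complex.I • B := by
  induction hX using Submodule.span_induction with
  | mem x hx =>
    exact ⟨0, Submodule.zero_mem _, -(Complex.I • x), Submodule.neg_mem _ (I_smul_mem_iMul hx), by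
      rw [smul_neg, smul_smul, Complex.I_mul_I]; simp⟩
  | zero => exact ⟨0, Submodule.zero_mem _, 0, Submodule.zero_mem _, by simp⟩
  | add x y _ _ hx hy =>
    obtain ⟨A, hA, B, hB, rfl⟩ := hx
    obtain ⟨A', hA', B', hB', rfl⟩ := hy
    exact ⟨A + A', Submodule.add_mem _ hA hA', B + B', Submodule.add_mem _ hB hB', by
      rw [smul_add]; abel⟩
  | smul c x _ hx =>
    obtain ⟨A, hA, B, hB, rfl⟩ := hx
    refine ⟨c.re • A - c.im • B, Submodule.sub_mem _ (Submodule.smul_mem _ _ hA)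
      (Submodule.smul_mem _ _ hB), c.im • A + c.re • B, Submodule.add_mem _
      (Submodule.smul_mem _ _ hA) (Submodule.smul_mem _ _ hB), ?_⟩
    ext i j
    simp only [Matrix.smul_apply, Matrix.add_apply, Matrix.sub_apply, smul_eq_mul,
      Complex.real_smul]
    nth_rw 1 [← Complex.re_add_im c]
    ring_nf
    rw [Complex.I_sq]
    ring

theorem conjTranspose_mem_complexSpan (hg : IsSkewHermitianAlgebra g) {X : Matrix n n ℂ}
    (hX : X ∈ complexSpan g) : X.conjTranspose ∈ complexSpan g := by
  obtain ⟨A, hA, B, hB, rfl⟩ := exists_eq_add_of_mem_complexSpan hX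
  rw [Matrix.conjTranspose_add, Matrix.conjTranspose_smul, isHermitian_of_mem_iMul hg hA,
    isHermitian_of_mem_iMul hg hB]
  exact Submodule.add_mem _ (mem_complexSpan_of_mem_iMul hA)
    (Submodule.smul_mem _ _ (mem_complexSpan_of_mem_iMul hB))

theorem commutator_mem_complexSpan {X Y : Matrix n n ℂ} (hX : X ∈ complexSpan g)
    (hY : Y ∈ complexSpan g) : X * Y - Y * X ∈ complexSpan g := by
  induction hX using Submodule.span_induction with
  | mem x hx =>
    induction hY using Submodule.span_induction with
    | mem y hy => exact Submodule.subset_span (g.lie_mem hx hy)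
    | zero => simp
    | add y z _ _ h1 h2 =>
      rw [show x * (y + z) - (y + z) * x = (x * y - y * x) + (x * z - z * x) by noncomm_ring]
      exact Submodule.add_mem _ h1 h2
    | smul c y _ h1 =>
      rw [mul_smul_comm, smul_mul_assoc, ← smul_sub]
      exact Submodule.smul_mem _ _ h1
  | zero => simp
  | add y z _ _ h1 h2 =>
    rw [show (y + z) * Y - Y * (y + z) = (y * Y - Y * y) + (z * Y - Y * z) by noncomm_ring]
    exact Submodule.add_mem _ h1 h2
  | smul c y _ h1 =>
    rw [mul_smul_comm, smul_mul_assoc, ← smul_sub]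
    exact Submodule.smul_mem _ _ h1

/-- A Hermitian element of `𝔤_ℂ` lies in `i𝔤`. -/
theorem mem_iMul_of_isHermitian (hg : IsSkewHermitianAlgebra g) {X : Matrix n n ℂ}
    (hX : X ∈ complexSpan g) (hherm : X.IsHermitian) : X ∈ iMul g.toSubmodule := by
  obtain ⟨A, hA, B, hB, rfl⟩ := exists_eq_add_of_mem_complexSpan hX
  rw [Matrix.IsHermitian, Matrix.conjTranspose_add, Matrix.conjTranspose_smul,
    isHermitian_of_mem_iMul hg hA, isHermitian_of_mem_iMul hg hB, add_right_inj, Complex.star_def,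
    Complex.conj_I, neg_smul] at hherm
  have h0 : Complex.I • B = 0 := by
    have h1 : (2 : ℂ) • (Complex.I • B) = 0 := by
      rw [two_smul]
      nth_rw 1 [← hherm]
      exact neg_add_cancel _
    exact (smul_eq_zero.1 h1).resolve_left two_ne_zero
  rw [h0, add_zero]
  exact hA

/-- Since `i𝔥` is Hermitian, `X†` commutes with it whenever `X` does. Hence so do both Hermitian
components of `X`, and these lie in `i𝔥`. -/
theorem mem_span_iCartan_of_commute (hg : IsSkewHermitianAlgebra g) (hh : h.IsCartanSubalgebra)
    {X : Matrix n n ℂ} (hX : X ∈ complexSpan g) (hc : ∀ H ∈ iCartan h, Commute X H) :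
    X ∈ Submodule.span ℂ (iCartan h : Set (Matrix n n ℂ)) := by
  obtain ⟨A, hA, B, hB, rfl⟩ := exists_eq_add_of_mem_complexSpan hX
  have key : ∀ H ∈ iCartan h, Commute (A - Complex.I • B) H := by
    intro H hH
    have h1 := congrArg Matrix.conjTranspose (hc H hH).eq
    rw [Matrix.conjTranspose_mul, Matrix.conjTranspose_mul, Matrix.conjTranspose_add,
      Matrix.conjTranspose_smul, isHermitian_of_mem_iMul hg hA, isHermitian_of_mem_iMul hg hB,
      isHermitian_of_mem_iMul hg (iCartan_le h hH), Complex.star_def, Complex.conj_I, neg_smul,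
      ← sub_eq_add_neg] at h1
    exact h1.symm
  have hA' : A ∈ iCartan h := mem_iCartan_of_commute hh hA fun H hH => by
    have h1 := ((hc H hH).add_left (key H hH)).smul_left (1 / 2 : ℂ)
    have h2 : (1 / 2 : ℂ) • (A + Complex.I • B + (A - Complex.I • B)) = A := by
      module
    rwa [h2] at h1
  have hB' : B ∈ iCartan h := mem_iCartan_of_commute hh hB fun H hH => by
    have h1 := ((hc H hH).sub_left (key H hH)).smul_left (-Complex.I / 2)
    have h2 : (-Complex.I / 2) • (A + Complex.I • B - (A - Complex.I • B)) = B := by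
      rw [add_sub_sub_cancel, ← two_smul ℂ, smul_smul, smul_smul]
      rw [show -Complex.I / 2 * 2 * Complex.I = -(Complex.I * Complex.I) by ring, Complex.I_mul_I]
      simp
    rwa [h2] at h1
  exact Submodule.add_mem _ (Submodule.subset_span hA')
    (Submodule.smul_mem _ _ (Submodule.subset_span hB'))

/-! ### Root space decomposition -/

variable (g) in
/-- The adjoint action of an element of `i𝔤` on `𝔤_ℂ`. -/
def adComplexSpan (H : iMul g.toSubmodule) : Module.End ℂ (complexSpan g) where
  toFun X := ⟨(H : Matrix n n ℂ) * X - X * H,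
    commutator_mem_complexSpan (mem_complexSpan_of_mem_iMul H.2) X.2⟩
  map_add' X Y := Subtype.ext (by simp only [Submodule.coe_add]; noncomm_ring)
  map_smul' c X := Subtype.ext (by
    simp only [Submodule.coe_smul, mul_smul_comm, smul_mul_assoc, smul_sub, RingHom.id_apply])

/-- Root space decomposition: `𝔤_ℂ` is spanned by `i𝔥` and the root vectors. -/
theorem complexSpan_le_span_rootVectors (hg : IsSkewHermitianAlgebra g)
    (hh : h.IsCartanSubalgebra) :
    complexSpan g ≤ Submodule.span ℂ
      ((iCartan h : Set (Matrix n n ℂ)) ∪ {E | ∃ α, IsRootVector h α E}) := by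
  let T : iCartan h → Module.End ℂ (complexSpan g) := fun H =>
    adComplexSpan g ⟨H, iCartan_le h H.2⟩
  -- `ad H` is symmetric for the Hilbert–Schmidt product because `H` is Hermitian.
  have hTs : ∀ (i : iCartan h) (x y : complexSpan g),
      (hsCore (complexSpan g)).inner (T i x) y = (hsCore (complexSpan g)).inner x (T i y) := by
    intro H X Y
    have hH := isHermitian_of_mem_iMul hg (iCartan_le h H.2)
    change (((H : Matrix n n ℂ) * X - X * H).conjTranspose * (Y : Matrix n n ℂ)).trace
      = ((X : Matrix n n ℂ).conjTranspose * ((H : Matrix n n ℂ) * Y - Y * H)).trace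
    rw [Matrix.conjTranspose_sub, Matrix.conjTranspose_mul, Matrix.conjTranspose_mul, hH, sub_mul,
      mul_sub, Matrix.trace_sub, Matrix.trace_sub, mul_assoc, mul_assoc (H : Matrix n n ℂ),
      Matrix.trace_mul_comm (H : Matrix n n ℂ), mul_assoc]
  have htop := iSup_iInf_eigenspace_eq_top (hsCore (complexSpan g)) T hTs (by
    intro H K
    ext X : 2
    have hc := (commute_of_mem_iCartan hg hh H.2 K.2).eq
    change (H : Matrix n n ℂ) * ((K : Matrix n n ℂ) * X - X * K) - ((K : Matrix n n ℂ) * X - X * K) * H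
      = (K : Matrix n n ℂ) * ((H : Matrix n n ℂ) * X - X * H) - ((H : Matrix n n ℂ) * X - X * H) * K
    calc _ = ((H : Matrix n n ℂ) * K) * X - H * X * K - K * X * H + X * (K * H) := by noncomm_ring
      _ = ((K : Matrix n n ℂ) * H) * X - H * X * K - K * X * H + X * (H * K) := by rw [hc]
      _ = _ := by noncomm_ring)
  intro X hX
  have hmem : (⟨X, hX⟩ : complexSpan g) ∈ ⨆ χ : iCartan h → ℂ, ⨅ i, (T i).eigenspace (χ i) := by
    rw [htop]; trivial
  have hle : (⨆ χ : iCartan h → ℂ, ⨅ i, (T i).eigenspace (χ i)) ≤ (Submodule.span ℂ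
      ((iCartan h : Set (Matrix n n ℂ)) ∪ {E | ∃ α, IsRootVector h α E})).comap
        (complexSpan g).subtype := by
    refine iSup_le fun χ Y hY => ?_
    rw [Submodule.mem_iInf] at hY
    have hY' : ∀ H : iCartan h, (H : Matrix n n ℂ) * Y - Y * H = χ H • (Y : Matrix n n ℂ) :=
      fun H => congrArg Subtype.val (Module.End.mem_eigenspace_iff.1 (hY H))
    rw [Submodule.mem_comap, Submodule.subtype_apply]
    by_cases h0 : (Y : Matrix n n ℂ) = 0
    · rw [h0]; exact Submodule.zero_mem _
    -- Dividing by `N` writes the eigenvalue `χ H` as a Rayleigh quotient of `ad H`, which shows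
    -- that it depends linearly on `H`.
    set N := ((Y : Matrix n n ℂ).conjTranspose * Y).trace with hN
    have hNne : N ≠ 0 := fun hz => h0 (Matrix.trace_conjTranspose_mul_self_eq_zero_iff.1 hz)
    have hNre : N = (N.re : ℂ) := by
      rw [hN, trace_conjTranspose_mul_self_eq_ofReal, Complex.ofReal_re]
    have hχ : ∀ H : iCartan h,
        χ H * N = ((Y : Matrix n n ℂ).conjTranspose * ((H : Matrix n n ℂ) * Y - Y * H)).trace := by
      intro H
      rw [hY' H, mul_smul_comm, Matrix.trace_smul, smul_eq_mul]
    have hreal : ∀ H : iCartan h, χ H = ((χ H).re : ℂ) := by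
      intro H
      have h1 := hTs H Y Y
      have h2 : T H Y = χ H • Y := Module.End.mem_eigenspace_iff.1 (hY H)
      rw [h2] at h1
      change ((χ H • (Y : Matrix n n ℂ)).conjTranspose * (Y : Matrix n n ℂ)).trace
        = ((Y : Matrix n n ℂ).conjTranspose * (χ H • (Y : Matrix n n ℂ))).trace at h1
      rw [Matrix.conjTranspose_smul, smul_mul_assoc, mul_smul_comm, Matrix.trace_smul,
        Matrix.trace_smul] at h1
      exact (Complex.conj_eq_iff_re.1 (mul_right_cancel₀ hNne h1)).symm
    have hlin : ∀ H : iCartan h, (χ H).re =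
        ((Y : Matrix n n ℂ).conjTranspose * ((H : Matrix n n ℂ) * Y - Y * H)).trace.re / N.re := by
      intro H
      have hNre' : N.re ≠ 0 := fun hz => hNne (by rw [hNre, hz, Complex.ofReal_zero])
      rw [eq_div_iff hNre', ← hχ, hNre, Complex.re_mul_ofReal, Complex.ofReal_re]
    let α : Module.Dual ℝ (iCartan h) :=
      { toFun := fun H => (χ H).re
        map_add' := fun H K => by
          rw [hlin, hlin, hlin, ← add_div, ← Complex.add_re, ← Matrix.trace_add, ← mul_add]
          congr 4
          rw [Submodule.coe_add]
          noncomm_ring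
        map_smul' := fun c H => by
          rw [hlin, hlin, RingHom.id_apply, Submodule.coe_smul, smul_mul_assoc, mul_smul_comm,
            ← smul_sub, mul_smul_comm, Matrix.trace_smul, Complex.smul_re, smul_eq_mul, smul_eq_mul,
            mul_div_assoc] }
    -- The joint eigenspace for `0` is the centralizer of `i𝔥` in `𝔤_ℂ`; every other eigenvector is
    -- a root vector.
    by_cases hα : α = 0
    · refine Submodule.span_mono Set.subset_union_left
        (mem_span_iCartan_of_commute hg hh Y.2 fun H hH => ?_)
      have h1 := hY' ⟨H, hH⟩
      rw [hreal ⟨H, hH⟩, show (χ ⟨H, hH⟩).re = α ⟨H, hH⟩ from rfl, hα, LinearMap.zero_apply,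
        Complex.ofReal_zero, zero_smul, sub_eq_zero] at h1
      exact h1.symm
    · exact Submodule.subset_span (Or.inr ⟨α, ⟨Y.2, h0, hα, fun H => by
        rw [Ring.lie_def, hY' H, hreal H]; rfl⟩⟩)
  exact hle hmem

end

section

variable {n : Type*} [Fintype n] [DecidableEq n]

variable {g : LieSubalgebra ℝ (Matrix n n ℂ)} {h : LieSubalgebra ℝ g}

/-! ### Weights -/

theorem dotProduct_mulVec_of_isHermitian {H : Matrix n n ℂ} (hH : H.IsHermitian) (x y : n → ℂ) :
    star (H.mulVec x) ⬝ᵥ y = star x ⬝ᵥ H.mulVec y := by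
  rw [Matrix.star_mulVec, hH.eq, Matrix.dotProduct_mulVec]

/-- Eigenvectors of a Hermitian matrix for different eigenvalues are orthogonal. -/
theorem HasWeight.eq_of_dotProduct_ne_zero (hg : IsSkewHermitianAlgebra g)
    {lam mu : Module.Dual ℝ (iCartan h)} {x y : EuclideanSpace ℂ n} (hx : HasWeight h lam x)
    (hy : HasWeight h mu y) (hxy : star x.ofLp ⬝ᵥ y.ofLp ≠ 0) : lam = mu := by
  ext H
  have h1 := dotProduct_mulVec_of_isHermitian (isHermitian_of_mem_iMul hg (iCartan_le h H.2))
    x.ofLp y.ofLp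
  rw [hx H, hy H, star_smul, smul_dotProduct, dotProduct_smul, Complex.star_def,
    Complex.conj_ofReal, smul_eq_mul, smul_eq_mul] at h1
  exact Complex.ofReal_injective (mul_right_cancel₀ hxy h1)

/-- There is an orthonormal basis of weight vectors, adapted to any Hermitian matrix that commutes
with the Cartan subalgebra. -/
theorem exists_weight_basis (hg : IsSkewHermitianAlgebra g) (hh : h.IsCartanSubalgebra)
    {ρ : Matrix n n ℂ} (hρ : ρ.IsHermitian) (hc : ∀ H ∈ iCartan h, Commute ρ H) :
    ∃ (b : OrthonormalBasis n ℂ (EuclideanSpace ℂ n)) (lam : n → Module.Dual ℝ (iCartan h))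
      (r : n → ℂ), (∀ v, HasWeight h (lam v) (b v)) ∧
        ∀ v, ρ.mulVec (b v).ofLp = r v • (b v).ofLp := by
  have hherm : ∀ H : iCartan h, (H : Matrix n n ℂ).IsHermitian := fun H =>
    isHermitian_of_mem_iMul hg (iCartan_le h H.2)
  -- The index `none` adds `ρ` to the commuting family `i𝔥`.
  obtain ⟨b, χ, hb⟩ := exists_orthonormalBasis_joint_eigenvectors
    (fun i : Option (iCartan h) => i.elim ρ fun H => (H : Matrix n n ℂ))
    (by rintro (_ | H)
        · exact hρ
        · exact hherm H)
    (by rintro (_ | H) (_ | K)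
        · exact Commute.refl _
        · exact hc _ K.2
        · exact (hc _ H.2).symm
        · exact commute_of_mem_iCartan hg hh H.2 K.2)
  have hnorm : ∀ v, star (b v).ofLp ⬝ᵥ (b v).ofLp = 1 := fun v => by
    have h1 : inner ℂ (b v) (b v) = 1 := by
      rw [inner_self_eq_norm_sq_to_K, b.orthonormal.1 v]; simp
    rw [EuclideanSpace.inner_eq_star_dotProduct, dotProduct_comm] at h1
    exact h1
  -- As an expectation value in a unit vector, the eigenvalue is real and linear in `H`.
  have hχ : ∀ v (H : iCartan h),
      χ v (some H) = star (b v).ofLp ⬝ᵥ (H : Matrix n n ℂ).mulVec (b v).ofLp := fun v H => by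
    have h1 := hb v (some H)
    rw [Option.elim_some] at h1
    rw [h1, dotProduct_smul, hnorm, smul_eq_mul, mul_one]
  have hreal : ∀ v (H : iCartan h), ((χ v (some H)).re : ℂ) = χ v (some H) := fun v H => by
    rw [← Complex.conj_eq_iff_re, ← Complex.star_def, hχ]
    conv_rhs => rw [← dotProduct_mulVec_of_isHermitian (hherm H)]
    rw [Matrix.star_dotProduct, star_star]
  refine ⟨b, fun v =>
    { toFun := fun H => (χ v (some H)).re
      map_add' := fun H K => by
        rw [← Complex.add_re, hχ, hχ, hχ, Submodule.coe_add, Matrix.add_mulVec, dotProduct_add]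
      map_smul' := fun c H => by
        rw [hχ, hχ, Submodule.coe_smul, Matrix.smul_mulVec, dotProduct_smul, Complex.smul_re,
          RingHom.id_apply] }, fun v => χ v none, fun v H => ?_, fun v => hb v none⟩
  change _ = (((χ v (some H)).re : ℝ) : ℂ) • _
  rw [hreal]
  exact hb v (some H)

/-- Otherwise `x` would be orthogonal to every basis vector. Thus only finitely many weights occur,
and maxima over them exist. -/
theorem HasWeight.exists_basis_eq (hg : IsSkewHermitianAlgebra g)
    {b : OrthonormalBasis n ℂ (EuclideanSpace ℂ n)} {lam : n → Module.Dual ℝ (iCartan h)}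
    (hb : ∀ v, HasWeight h (lam v) (b v)) {mu : Module.Dual ℝ (iCartan h)}
    {x : EuclideanSpace ℂ n} (hx : HasWeight h mu x) (h0 : x ≠ 0) : ∃ v, lam v = mu := by
  by_contra! hne
  refine h0 (InnerProductSpace.ext_inner_left_basis (𝕜 := ℂ) b.toBasis fun v => ?_)
  rw [inner_zero_right, b.coe_toBasis, EuclideanSpace.inner_eq_star_dotProduct, dotProduct_comm]
  by_contra hd
  exact hne v ((hb v).eq_of_dotProduct_ne_zero hg hx hd)

/-! ### Root vectors -/

theorem IsRootVector.mul_sub_mul {α : Module.Dual ℝ (iCartan h)} {E : Matrix n n ℂ}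
    (hE : IsRootVector h α E) (H : iCartan h) :
    (H : Matrix n n ℂ) * E - E * H = ((α H : ℝ) : ℂ) • E := by
  rw [← hE.bracket H, Ring.lie_def]

/-- Roots take real values on the Hermitian space `i𝔥`, so taking adjoints in `[H, E] = α(H) E` only
changes the sign: adjoints exchange raising and lowering operators. -/
theorem IsRootVector.conjTranspose (hg : IsSkewHermitianAlgebra g)
    {α : Module.Dual ℝ (iCartan h)} {E : Matrix n n ℂ} (hE : IsRootVector h α E) :
    IsRootVector h (-α) E.conjTranspose where
  mem := conjTranspose_mem_complexSpan hg hE.mem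
  vec_ne_zero := by
    rw [Ne, Matrix.conjTranspose_eq_zero]
    exact hE.vec_ne_zero
  root_ne_zero := neg_ne_zero.2 hE.root_ne_zero
  bracket H := by
    have h1 := congrArg Matrix.conjTranspose (hE.mul_sub_mul H)
    rw [Matrix.conjTranspose_sub, Matrix.conjTranspose_mul, Matrix.conjTranspose_mul,
      Matrix.conjTranspose_smul, isHermitian_of_mem_iMul hg (iCartan_le h H.2), Complex.star_def,
      Complex.conj_ofReal] at h1
    rw [Ring.lie_def, ← neg_sub, h1, LinearMap.neg_apply, Complex.ofReal_neg, neg_smul]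

theorem HasWeight.mulVec_root {lam α : Module.Dual ℝ (iCartan h)} {E : Matrix n n ℂ}
    {x : EuclideanSpace ℂ n} (hx : HasWeight h lam x) (hE : IsRootVector h α E) :
    HasWeight h (lam + α) (WithLp.toLp 2 (E.mulVec x.ofLp)) := by
  intro H
  have h1 : (H : Matrix n n ℂ) * E = E * H + ((α H : ℝ) : ℂ) • E := by
    rw [← hE.mul_sub_mul H]; abel
  change (H : Matrix n n ℂ).mulVec (E.mulVec x.ofLp) = _ • E.mulVec x.ofLp
  rw [Matrix.mulVec_mulVec, h1, Matrix.add_mulVec, ← Matrix.mulVec_mulVec, hx H, Matrix.mulVec_smul,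
    Matrix.smul_mulVec, ← add_smul, LinearMap.add_apply, Complex.ofReal_add]

/-! ### Weights as elements of `i𝔥`, and their lengths -/

theorem trace_conjTranspose_mul_self_re_pos {E : Matrix n n ℂ} (hE : E ≠ 0) :
    0 < (E.conjTranspose * E).trace.re :=
  (trace_conjTranspose_mul_self_re_nonneg E).lt_of_ne fun h0 =>
    hE (eq_zero_of_trace_conjTranspose_mul_self_re h0.symm)

/-- The element of `i𝔥` that represents `lam`, given an orthonormal basis of `i𝔥`. -/
noncomputable def dualVec {d : ℕ} (B : Module.Basis (Fin d) ℝ (iCartan h))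
    (lam : Module.Dual ℝ (iCartan h)) : iCartan h :=
  ∑ j, lam (B j) • B j

theorem apply_dualVec {d : ℕ} (B : Module.Basis (Fin d) ℝ (iCartan h))
    (lam mu : Module.Dual ℝ (iCartan h)) :
    mu (dualVec B lam) = ∑ j, lam (B j) * mu (B j) := by
  simp [dualVec]

theorem apply_dualVec_self {d : ℕ} (B : Module.Basis (Fin d) ℝ (iCartan h))
    (lam : Module.Dual ℝ (iCartan h)) :
    lam (dualVec B lam) = weightNormSq B lam := by
  simp [apply_dualVec, weightNormSq, pow_two]

/-- Both sides are linear in `H` and agree on the basis; this is where its orthonormality enters. -/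
theorem trace_dualVec_mul (hg : IsSkewHermitianAlgebra g) {d : ℕ}
    {B : Module.Basis (Fin d) ℝ (iCartan h)} (hB : IsHSOrthonormal B)
    (lam : Module.Dual ℝ (iCartan h)) (H : iCartan h) :
    ((dualVec B lam : Matrix n n ℂ) * (H : Matrix n n ℂ)).trace.re = lam H := by
  have hBH : ∀ i, (B i : Matrix n n ℂ).conjTranspose = B i := fun i =>
    isHermitian_of_mem_iMul hg (iCartan_le h (B i).2)
  let F : Module.Dual ℝ (iCartan h) :=
    { toFun := fun H => ((dualVec B lam : Matrix n n ℂ) * (H : Matrix n n ℂ)).trace.re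
      map_add' := fun H K => by simp [mul_add]
      map_smul' := fun c H => by simp }
  have hF : F = lam := B.ext fun i => by
    change ((dualVec B lam : Matrix n n ℂ) * (B i : Matrix n n ℂ)).trace.re = lam (B i)
    have h1 : ∀ j, ((B j : Matrix n n ℂ) * (B i : Matrix n n ℂ)).trace = if j = i then 1 else 0 :=
      fun j => by
        have := hB j i
        rwa [hBH] at this
    simp only [dualVec, Submodule.coe_sum, Submodule.coe_smul, Finset.sum_mul, smul_mul_assoc,
      Matrix.trace_sum, Matrix.trace_smul, h1, Complex.re_sum, Complex.smul_re]
    rw [Finset.sum_eq_single i (fun j _ hj => by simp [hj]) (by simp)]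
    simp
  exact LinearMap.congr_fun hF H

theorem weightNormSq_pos {d : ℕ} (B : Module.Basis (Fin d) ℝ (iCartan h))
    {lam : Module.Dual ℝ (iCartan h)} (hlam : lam ≠ 0) : 0 < weightNormSq B lam := by
  refine (Finset.sum_nonneg fun j _ => sq_nonneg _).lt_of_ne fun h0 => hlam ?_
  refine B.ext fun j => ?_
  have := (Finset.sum_eq_zero_iff_of_nonneg fun j _ => sq_nonneg (lam (B j))).1 h0.symm j
    (Finset.mem_univ _)
  simpa using this

theorem weightNormSq_add_smul {d : ℕ} (B : Module.Basis (Fin d) ℝ (iCartan h))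
    (lam α : Module.Dual ℝ (iCartan h)) (t : ℝ) :
    weightNormSq B (lam + t • α) =
      weightNormSq B lam + 2 * t * lam (dualVec B α) + t ^ 2 * weightNormSq B α := by
  rw [apply_dualVec]
  simp only [weightNormSq, LinearMap.add_apply, LinearMap.smul_apply, smul_eq_mul, Finset.mul_sum,
    ← Finset.sum_add_distrib]
  exact Finset.sum_congr rfl fun j _ => by ring

/-- `[E, E†]` is a positive multiple of the element of `i𝔥` that represents the root. -/
theorem IsRootVector.mul_conjTranspose_sub (hg : IsSkewHermitianAlgebra g)
    (hh : h.IsCartanSubalgebra) {d : ℕ} {B : Module.Basis (Fin d) ℝ (iCartan h)}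
    (hB : IsHSOrthonormal B) {α : Module.Dual ℝ (iCartan h)} {E : Matrix n n ℂ}
    (hE : IsRootVector h α E) :
    E * E.conjTranspose - E.conjTranspose * E =
      (E.conjTranspose * E).trace.re • (dualVec B α : Matrix n n ℂ) := by
  set N := (E.conjTranspose * E).trace.re with hN
  set K := E * E.conjTranspose - E.conjTranspose * E with hK
  have hKh : K.IsHermitian := by
    rw [Matrix.IsHermitian, hK, Matrix.conjTranspose_sub, Matrix.conjTranspose_mul,
      Matrix.conjTranspose_mul, Matrix.conjTranspose_conjTranspose]
  have hKg : K ∈ iMul g.toSubmodule := mem_iMul_of_isHermitian hg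
    (commutator_mem_complexSpan hE.mem (conjTranspose_mem_complexSpan hg hE.mem)) hKh
  -- `E` and `E†` have opposite roots, so their commutator commutes with `i𝔥`.
  have hKc : K ∈ iCartan h := by
    refine mem_iCartan_of_commute hh hKg fun H hH => ?_
    have h1 := hE.mul_sub_mul ⟨H, hH⟩
    have h2 := (hE.conjTranspose hg).mul_sub_mul ⟨H, hH⟩
    rw [LinearMap.neg_apply, Complex.ofReal_neg] at h2
    set a : ℂ := ((α ⟨H, hH⟩ : ℝ) : ℂ)
    refine Eq.symm (sub_eq_zero.1 ?_)
    calc H * K - K * H = (H * E - E * H) * E.conjTranspose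
          + E * (H * E.conjTranspose - E.conjTranspose * H)
          - (H * E.conjTranspose - E.conjTranspose * H) * E
          - E.conjTranspose * (H * E - E * H) := by rw [hK]; noncomm_ring
      _ = 0 := by
        rw [h1, h2]
        simp
  -- Invariance of the trace form: `Tr[[E, E†]H] = Tr[E†[H, E]]`.
  have htr : ∀ H : iCartan h, (K * (H : Matrix n n ℂ)).trace.re = N * α H := by
    intro H
    have h1 : (K * (H : Matrix n n ℂ)).trace
        = (E.conjTranspose * ((H : Matrix n n ℂ) * E - E * H)).trace := by
      rw [hK, sub_mul, mul_sub, Matrix.trace_sub, Matrix.trace_sub, mul_assoc E,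
        Matrix.trace_mul_comm E, mul_assoc, mul_assoc]
    rw [h1, hE.mul_sub_mul H, mul_smul_comm, Matrix.trace_smul, smul_eq_mul, Complex.re_ofReal_mul,
      mul_comm]
  -- `D ∈ i𝔥` is trace-orthogonal to all of `i𝔥`, in particular to itself.
  let D : iCartan h := ⟨K, hKc⟩ - N • dualVec B α
  have hD : (D : Matrix n n ℂ) = K - N • (dualVec B α : Matrix n n ℂ) := rfl
  have hD0 : (D : Matrix n n ℂ) = 0 := by
    refine eq_zero_of_trace_conjTranspose_mul_self_re ?_
    rw [(isHermitian_of_mem_iMul hg (iCartan_le h D.2)).eq]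
    nth_rw 1 [hD]
    rw [sub_mul, smul_mul_assoc, Matrix.trace_sub, Matrix.trace_smul, Complex.sub_re,
      Complex.smul_re, htr, trace_dualVec_mul hg hB, smul_eq_mul, sub_self]
  rw [hD] at hD0
  exact sub_eq_zero.1 hD0

/-! ### Highest weights -/

/-- A weight of maximal norm, and of maximal height among those, is a highest weight: the string
of a positive root through it would reach its mirror image, which is higher. -/
theorem mulVec_eq_zero_of_maximal (hg : IsSkewHermitianAlgebra g)
    (hh : h.IsCartanSubalgebra) {d : ℕ} {B : Module.Basis (Fin d) ℝ (iCartan h)}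
    (hB : IsHSOrthonormal B) {H₀ : iCartan h} {mu : Module.Dual ℝ (iCartan h)}
    {w : EuclideanSpace ℂ n} (hw : HasWeight h mu w)
    (hmax : ∀ nu (x : EuclideanSpace ℂ n), HasWeight h nu x → x ≠ 0 →
      weightNormSq B nu ≤ weightNormSq B mu ∧
        (weightNormSq B nu = weightNormSq B mu → nu H₀ ≤ mu H₀))
    {α : Module.Dual ℝ (iCartan h)} {E : Matrix n n ℂ} (hE : IsRootVector h α E)
    (hpos : 0 < α H₀) : E.mulVec w.ofLp = 0 := by
  by_contra hEw
  set N := (E.conjTranspose * E).trace.re with hN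
  have hNpos : 0 < N := trace_conjTranspose_mul_self_re_pos hE.vec_ne_zero
  set a := weightNormSq B α with ha
  have hapos : 0 < a := weightNormSq_pos B hE.root_ne_zero
  set m := mu (dualVec B α) with hm
  have hK : ∀ y : n → ℂ, E.conjTranspose.mulVec (E.mulVec y) =
      E.mulVec (E.conjTranspose.mulVec y) - (N : ℂ) • (dualVec B α : Matrix n n ℂ).mulVec y := by
    intro y
    have h1 := hE.mul_conjTranspose_sub hg hh hB
    have h2 : E.conjTranspose * E = E * E.conjTranspose - N • (dualVec B α : Matrix n n ℂ) := by
      rw [← h1]; abel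
    rw [Matrix.mulVec_mulVec, h2, Matrix.sub_mulVec, Matrix.mulVec_mulVec, Matrix.smul_mulVec,
      Complex.coe_smul]
  -- The `α`-string through `w`: `x j = E^j w` has weight `mu + jα`, whose squared length exceeds
  -- that of `mu` by `2jm + j²a`.
  let x : ℕ → n → ℂ := fun j => (E.mulVec)^[j] w.ofLp
  have hxs : ∀ j, x (j + 1) = E.mulVec (x j) := fun j => Function.iterate_succ_apply' _ _ _
  have hxw : ∀ j : ℕ, HasWeight h (mu + (j : ℝ) • α) (WithLp.toLp 2 (x j)) := by
    intro j
    induction j with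
    | zero => simpa [x] using hw
    | succ j ih =>
      have h1 := ih.mulVec_root hE
      rw [add_assoc] at h1
      rw [hxs, Nat.cast_succ, add_smul, one_smul]
      exact h1
  have hle : ∀ j : ℕ, x j ≠ 0 → 2 * (j : ℝ) * m + (j : ℝ) ^ 2 * a ≤ 0 := by
    intro j hj
    have h1 := (hmax _ _ (hxw j) (fun hz => hj (congrArg WithLp.ofLp hz))).1
    rw [weightNormSq_add_smul] at h1
    linarith
  have hm_neg : m < 0 := by
    have h1 := hle 1 (by rw [hxs]; exact hEw)
    norm_num at h1
    linarith
  -- `E† w` would have weight `mu - α`, longer than `mu` because `m < 0`. So `w` is at the bottom of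
  -- its string.
  have hlow : E.conjTranspose.mulVec w.ofLp = 0 := by
    by_contra hne
    have h1 := (hmax _ _ (hw.mulVec_root (hE.conjTranspose hg))
      (fun hz => hne (congrArg WithLp.ofLp hz))).1
    rw [← neg_one_smul ℝ α, weightNormSq_add_smul] at h1
    linarith
  -- In an infinite string the term `j²a` would eventually make the weights longer than `mu`.
  have hterm : ∃ j, x j = 0 := by
    by_contra! hne
    obtain ⟨j, hj⟩ := exists_nat_gt (-(2 * m) / a)
    have h1 := hle j (hne j)
    rw [div_lt_iff₀ hapos] at hj
    have hjpos : (0 : ℝ) < j := by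
      rcases Nat.eq_zero_or_pos j with h0 | h0
      · rw [h0, Nat.cast_zero, zero_mul] at hj; linarith
      · exact_mod_cast h0
    nlinarith
  classical
  obtain ⟨k, hk⟩ : ∃ k, Nat.find hterm = k + 1 := by
    refine Nat.exists_eq_succ_of_ne_zero fun h0 => hEw ?_
    have h1 : w.ofLp = 0 := (Nat.find_eq_zero hterm).1 h0
    rw [h1, Matrix.mulVec_zero]
  have hk1 : x (k + 1) = 0 := hk ▸ Nat.find_spec hterm
  have hk0 : x k ≠ 0 := Nat.find_min hterm (by omega)
  have hkpos : k ≠ 0 := by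
    rintro rfl
    exact hEw (by rw [← hk1, hxs]; rfl)
  have hdual : ∀ j : ℕ, (dualVec B α : Matrix n n ℂ).mulVec (x j) = ((m + j * a : ℝ) : ℂ) • x j := by
    intro j
    have h1 := hxw j (dualVec B α)
    rw [LinearMap.add_apply, LinearMap.smul_apply, apply_dualVec_self, smul_eq_mul] at h1
    exact h1
  -- As in `𝔰𝔩₂`: commuting `E†` past one more `E` subtracts `N` times the value `m + ja` of the
  -- current weight.
  have hstep : ∀ j : ℕ, E.conjTranspose.mulVec (x (j + 1)) =
      ((-N * ∑ i ∈ Finset.range (j + 1), (m + i * a) : ℝ) : ℂ) • x j := by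
    intro j
    induction j with
    | zero =>
      rw [hxs, hK, hdual]
      change E.mulVec (E.conjTranspose.mulVec w.ofLp) - _ = _
      rw [hlow, Matrix.mulVec_zero, zero_sub, smul_smul, ← neg_smul]
      congr 1
      simp
    | succ j ih =>
      rw [hxs (j + 1), hK, ih, hdual, Matrix.mulVec_smul, ← hxs, smul_smul, ← sub_smul,
        Finset.sum_range_succ _ (j + 1)]
      congr 1
      push_cast
      ring
  -- `x k` is the last nonzero vector, so the coefficient of `hstep` vanishes at `k`. Summing the
  -- arithmetic progression gives `2m + ka = 0`: `mu + kα` is the reflection of `mu` in `α`.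
  have hsum : ∑ i ∈ Finset.range (k + 1), (m + i * a) = 0 := by
    have h1 := hstep k
    rw [hk1, Matrix.mulVec_zero] at h1
    have h2 := (smul_eq_zero.1 h1.symm).resolve_right hk0
    have h3 : -N * ∑ i ∈ Finset.range (k + 1), (m + i * a) = 0 := by exact_mod_cast h2
    exact (mul_eq_zero.1 h3).resolve_left (by linarith)
  have hkm : 2 * m + k * a = 0 := by
    have h1 : ∀ k : ℕ, 2 * ∑ i ∈ Finset.range (k + 1), (m + i * a) = (k + 1) * (2 * m + k * a) := by
      intro k
      induction k with
      | zero => simp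
      | succ k ih =>
        rw [Finset.sum_range_succ, mul_add, ih]
        push_cast
        ring
    have h2 := h1 k
    rw [hsum, mul_zero] at h2
    exact (mul_eq_zero.1 h2.symm).resolve_left (by positivity)
  -- The reflected weight is as long as `mu`, but its height is larger by `k α(H₀) > 0`.
  have hfin := (hmax _ _ (hxw k) (fun hz => hk0 (congrArg WithLp.ofLp hz))).2 (by
    rw [weightNormSq_add_smul, ← hm, ← ha]
    linear_combination (k : ℝ) * hkm)
  rw [LinearMap.add_apply, LinearMap.smul_apply, smul_eq_mul] at hfin
  have : (0 : ℝ) < k := by positivity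
  nlinarith

/-- In an irreducible representation, two highest weight vectors have the same weight. -/
theorem HasWeight.eq_of_annihilated (hg : IsSkewHermitianAlgebra g) (hh : h.IsCartanSubalgebra)
    (hirr : ActsIrreducibly g) {H₀ : iCartan h} (hreg : IsRegularElement H₀)
    {lam mu : Module.Dual ℝ (iCartan h)} {v w : EuclideanSpace ℂ n} (hv : HasWeight h lam v)
    (hw : HasWeight h mu w) (hv0 : v ≠ 0) (hw0 : w ≠ 0)
    (hva : ∀ α E, IsRootVector h α E → 0 < α H₀ → E.mulVec v.ofLp = 0)
    (hwa : ∀ α E, IsRootVector h α E → 0 < α H₀ → E.mulVec w.ofLp = 0) : lam = mu := by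
  set L : Set (Matrix n n ℂ) :=
    (iCartan h : Set (Matrix n n ℂ)) ∪ {E | ∃ α, IsRootVector h α E ∧ α H₀ < 0} with hL
  have hLg : ∀ Y ∈ L, Y ∈ complexSpan g := by
    rintro Y (hY | ⟨α, hY, -⟩)
    · exact mem_complexSpan_of_mem_iMul (iCartan_le h hY)
    · exact hY.mem
  -- `W` is what the Cartan and lowering operators generate from `v`. It is shown to be
  -- `𝔤`-invariant, hence everything.
  let W : Submodule ℂ (n → ℂ) := sInf {S | v.ofLp ∈ S ∧ ∀ Y ∈ L, ∀ x ∈ S, Y.mulVec x ∈ S}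
  have hvW : v.ofLp ∈ W := (Submodule.mem_sInf).2 fun S hS => hS.1
  have hWL : ∀ Y ∈ L, ∀ x ∈ W, Y.mulVec x ∈ W := fun Y hY x hx => (Submodule.mem_sInf).2 fun S hS =>
    hS.2 Y hY x ((Submodule.mem_sInf).1 hx S hS)
  have hWv : ∀ X ∈ complexSpan g, X.mulVec v.ofLp ∈ W := by
    intro X hX
    replace hX := complexSpan_le_span_rootVectors hg hh hX
    induction hX using Submodule.span_induction with
    | mem Y hY =>
      rcases hY with hY | ⟨α, hα⟩
      · exact hWL Y (Or.inl hY) _ hvW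
      · rcases lt_trichotomy (α H₀) 0 with h1 | h1 | h1
        · exact hWL Y (Or.inr ⟨α, hα, h1⟩) _ hvW
        · exact absurd h1 (hreg α Y hα)
        · rw [hva α Y hα h1]; exact W.zero_mem
    | zero => rw [Matrix.zero_mulVec]; exact W.zero_mem
    | add X Y _ _ h1 h2 => rw [Matrix.add_mulVec]; exact W.add_mem h1 h2
    | smul c X _ h1 => rw [Matrix.smul_mulVec]; exact W.smul_mem c h1
  -- The vectors of `W` that `𝔤_ℂ` keeps in `W`. By `XY = YX + [X, Y]` this space is stable under
  -- `L`, so minimality of `W` gives `W ≤ W'`.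
  let W' : Submodule ℂ (n → ℂ) :=
    { carrier := {x | x ∈ W ∧ ∀ X ∈ complexSpan g, X.mulVec x ∈ W}
      add_mem' := fun {x y} hx hy => ⟨W.add_mem hx.1 hy.1, fun X hX => by
        rw [Matrix.mulVec_add]; exact W.add_mem (hx.2 X hX) (hy.2 X hX)⟩
      zero_mem' := ⟨W.zero_mem, fun X _ => by rw [Matrix.mulVec_zero]; exact W.zero_mem⟩
      smul_mem' := fun c x hx => ⟨W.smul_mem c hx.1, fun X hX => by
        rw [Matrix.mulVec_smul]; exact W.smul_mem c (hx.2 X hX)⟩ }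
  have hWW' : W ≤ W' := sInf_le ⟨⟨hvW, hWv⟩, fun Y hY x hx => ⟨hWL Y hY x hx.1, fun X hX => by
    have h1 : X.mulVec (Y.mulVec x) = Y.mulVec (X.mulVec x) + (X * Y - Y * X).mulVec x := by
      rw [Matrix.sub_mulVec, Matrix.mulVec_mulVec, Matrix.mulVec_mulVec]; abel
    rw [h1]
    exact W.add_mem (hWL Y hY _ (hx.2 X hX))
      (hx.2 _ (commutator_mem_complexSpan hX (hLg Y hY)))⟩⟩
  have hWtop : W = ⊤ := (hirr W fun X hX x hx =>
    (hWW' hx).2 X (Submodule.subset_span hX)).resolve_left fun hbot => by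
      rw [hbot, Submodule.mem_bot] at hvW
      exact hv0 (WithLp.ofLp_injective 2 hvW)
  -- If `w ⟂ v`, then `w^⊥` contains `v` and is stable under `L`: `w` is an eigenvector of `i𝔥`, and
  -- adjoints of lowering operators are raising operators, which kill `w`. Then `W ≤ w^⊥`, so `w ⟂
  -- w`.
  refine Eq.symm (hw.eq_of_dotProduct_ne_zero hg hv fun horth => hw0 ?_)
  let W'' : Submodule ℂ (n → ℂ) :=
    { carrier := {x | star w.ofLp ⬝ᵥ x = 0}
      add_mem' := fun {x y} hx hy => by
        rw [Set.mem_ofPred_eq] at *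
        rw [dotProduct_add, hx, hy, add_zero]
      zero_mem' := dotProduct_zero _
      smul_mem' := fun c x hx => by
        rw [Set.mem_ofPred_eq] at *
        rw [dotProduct_smul, hx, smul_zero] }
  have hadj : ∀ (Y : Matrix n n ℂ) (x : n → ℂ),
      star w.ofLp ⬝ᵥ Y.mulVec x = star (Y.conjTranspose.mulVec w.ofLp) ⬝ᵥ x := by
    intro Y x
    rw [Matrix.star_mulVec, Matrix.conjTranspose_conjTranspose, Matrix.dotProduct_mulVec]
  have hle : W ≤ W'' := sInf_le ⟨horth, by
    rintro Y (hY | ⟨α, hY, hα⟩) x hx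
    · change star w.ofLp ⬝ᵥ Y.mulVec x = 0
      rw [hadj, isHermitian_of_mem_iMul hg (iCartan_le h hY), hw ⟨Y, hY⟩, star_smul,
        smul_dotProduct, show star w.ofLp ⬝ᵥ x = 0 from hx, smul_zero]
    · change star w.ofLp ⬝ᵥ Y.mulVec x = 0
      rw [hadj, hwa _ _ (hY.conjTranspose hg) (by rw [LinearMap.neg_apply]; linarith), star_zero,
        zero_dotProduct]⟩
  have hself : w.ofLp ∈ W'' := hle (hWtop ▸ Submodule.mem_top)
  exact WithLp.ofLp_injective 2 (dotProduct_star_self_eq_zero.1 hself)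

/-- All weights of an irreducible representation are at most as long as the highest one. -/
theorem weightNormSq_le_of_isHighestWeightVector (hg : IsSkewHermitianAlgebra g)
    (hh : h.IsCartanSubalgebra) (hirr : ActsIrreducibly g) {d : ℕ}
    {B : Module.Basis (Fin d) ℝ (iCartan h)} (hB : IsHSOrthonormal B) {H₀ : iCartan h}
    (hreg : IsRegularElement H₀) {v : EuclideanSpace ℂ n} (hv : IsHighestWeightVector H₀ v)
    {lam nu : Module.Dual ℝ (iCartan h)} (hlam : HasWeight h lam v) {x : EuclideanSpace ℂ n}
    (hx : HasWeight h nu x) (hx0 : x ≠ 0) : weightNormSq B nu ≤ weightNormSq B lam := by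
  have hv0 : v ≠ 0 := by
    rintro rfl
    simpa using hv.norm_eq_one
  obtain ⟨b, mu, -, hb, -⟩ := exists_weight_basis hg hh (Matrix.isHermitian_zero)
    (fun H _ => Commute.zero_left H)
  obtain ⟨i₀, -⟩ := hx.exists_basis_eq hg hb hx0
  -- The lexicographic order selects the longest weights first and the greatest height among them
  -- second.
  obtain ⟨i, -, hi⟩ := Finset.exists_max_image Finset.univ
    (fun i => toLex (weightNormSq B (mu i), mu i H₀)) ⟨i₀, Finset.mem_univ _⟩
  have hmax : ∀ nu (x : EuclideanSpace ℂ n), HasWeight h nu x → x ≠ 0 →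
      weightNormSq B nu ≤ weightNormSq B (mu i) ∧
        (weightNormSq B nu = weightNormSq B (mu i) → nu H₀ ≤ mu i H₀) := by
    intro nu x hx hx0
    obtain ⟨j, rfl⟩ := hx.exists_basis_eq hg hb hx0
    rcases Prod.Lex.toLex_le_toLex.1 (hi j (Finset.mem_univ _)) with h1 | ⟨h1, h2⟩
    · exact ⟨h1.le, fun h2 => absurd h2 h1.ne⟩
    · exact ⟨h1.le, fun _ => h2⟩
  have hbi : b i ≠ 0 := b.orthonormal.ne_zero i
  have : lam = mu i := hlam.eq_of_annihilated hg hh hirr hreg (hb i) hv0 hbi hv.annihilated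
    fun α E hE hpos => mulVec_eq_zero_of_maximal hg hh hB (hb i) hmax hE hpos
  rw [this]
  exact (hmax nu x hx hx0).1

end

section

variable {n : Type*} [Fintype n] [DecidableEq n]

/-! ### Conjugation by exponentials -/

section Exponential

open NormedSpace

section NormedAlgebra

variable {A : Type*} [NormedRing A] [NormedAlgebra ℝ A] [FiniteDimensional ℝ A]

/-- Comparison of power series. With its right-handed companion it turns conjugation by `exp x` into
the exponential of `ad x`. -/
theorem exp_mul_apply (x y : A) : exp (ContinuousLinearMap.mul ℝ A x) y = exp x * y := by
  have : CompleteSpace A := FiniteDimensional.complete ℝ A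
  have hpow : ∀ k : ℕ, (ContinuousLinearMap.mul ℝ A x ^ k) y = x ^ k * y := by
    intro k
    induction k with
    | zero => rw [pow_zero, pow_zero, one_mul]; rfl
    | succ k ih =>
      rw [pow_succ', pow_succ', mul_assoc, ← ih]
      rfl
  have h1 := (exp_series_hasSum_exp' (𝕂 := ℝ) (ContinuousLinearMap.mul ℝ A x)).mapL
    (ContinuousLinearMap.apply ℝ A y)
  have h2 := (exp_series_hasSum_exp' (𝕂 := ℝ) x).mul_right y
  simp only [map_smul, ContinuousLinearMap.apply_apply, hpow] at h1
  simp only [smul_mul_assoc] at h2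
  exact h1.unique h2

theorem exp_mul_flip_apply (x y : A) :
    exp ((ContinuousLinearMap.mul ℝ A).flip x) y = y * exp x := by
  have : CompleteSpace A := FiniteDimensional.complete ℝ A
  have hpow : ∀ k : ℕ, ((ContinuousLinearMap.mul ℝ A).flip x ^ k) y = y * x ^ k := by
    intro k
    induction k with
    | zero => rw [pow_zero, pow_zero, mul_one]; rfl
    | succ k ih =>
      rw [pow_succ', pow_succ, ← mul_assoc, ← ih]
      rfl
  have h1 := (exp_series_hasSum_exp' (𝕂 := ℝ) ((ContinuousLinearMap.mul ℝ A).flip x)).mapL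
    (ContinuousLinearMap.apply ℝ A y)
  have h2 := (exp_series_hasSum_exp' (𝕂 := ℝ) x).mul_left y
  simp only [map_smul, ContinuousLinearMap.apply_apply, hpow] at h1
  simp only [mul_smul_comm] at h2
  exact h1.unique h2

/-- A subspace that is stable under `ad x` is stable under conjugation by `exp x`. -/
theorem exp_mul_mul_exp_neg_mem {S : Submodule ℝ A} {x : A}
    (hx : ∀ y ∈ S, x * y - y * x ∈ S) {y : A} (hy : y ∈ S) :
    exp x * y * exp (-x) ∈ S := by
  have : CompleteSpace A := FiniteDimensional.complete ℝ A
  let : NormedAlgebra ℚ (A →L[ℝ] A) := .restrictScalars ℚ ℝ _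
  set L := ContinuousLinearMap.mul ℝ A x with hL
  set R := (ContinuousLinearMap.mul ℝ A).flip (-x) with hR
  have hcomm : Commute L R := by
    ext z : 1
    change x * (z * -x) = x * z * -x
    rw [mul_assoc]
  have h1 : exp x * y * exp (-x) = exp (L + R) y := by
    rw [mul_assoc, ← exp_mul_flip_apply, ← exp_mul_apply, exp_add_of_commute hcomm]
    rfl
  have hclosed : IsClosed (S : Set A) := S.closed_of_finiteDimensional
  have h2 := (exp_series_hasSum_exp' (𝕂 := ℝ) (L + R)).mapL
    (ContinuousLinearMap.apply ℝ A y)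
  rw [h1]
  -- All partial sums of `exp (ad x) y` lie in `S`, which is closed by finite dimension.
  refine hclosed.mem_of_tendsto h2 (Filter.Eventually.of_forall fun s => S.sum_mem fun k _ => ?_)
  refine S.smul_mem _ ?_
  clear * - hx hy
  induction k with
  | zero => exact hy
  | succ k ih =>
    rw [pow_succ']
    have h3 := hx _ ih
    convert h3 using 1
    change x * _ + _ * -x = _
    rw [mul_neg, sub_eq_add_neg]

/-- The commutator is the derivative at `t = 0` of a curve in `S`, and `S` is closed. -/
theorem commutator_mem_of_exp_conj_sub_mem {S : Submodule ℝ A} {x a : A}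
    (hS : ∀ t : ℝ, exp (t • x) * a * exp (-(t • x)) - a ∈ S) : x * a - a * x ∈ S := by
  have : CompleteSpace A := FiniteDimensional.complete ℝ A
  have h1 : HasDerivAt (fun t : ℝ => exp (t • x)) x 0 := by
    have := hasDerivAt_exp_smul_const (𝕂 := ℝ) x (0 : ℝ)
    rwa [zero_smul, exp_zero, one_mul] at this
  have h2 : HasDerivAt (fun t : ℝ => exp (-(t • x))) (-x) 0 := by
    have := hasDerivAt_exp_smul_const (𝕂 := ℝ) (-x) (0 : ℝ)
    rw [zero_smul, exp_zero, one_mul] at this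
    simpa only [smul_neg] using this
  have h3 : HasDerivAt (fun t : ℝ => exp (t • x) * a * exp (-(t • x)) - a) (x * a - a * x) 0 := by
    have := ((h1.mul_const a).mul h2).sub_const a
    simp only [zero_smul, neg_zero, exp_zero, mul_one, one_mul, mul_neg, ← sub_eq_add_neg] at this
    exact this
  have hclosed : IsClosed (S : Set A) := S.closed_of_finiteDimensional
  refine hclosed.mem_of_tendsto h3.tendsto_slope_zero (Filter.Eventually.of_forall fun t => ?_)
  exact S.smul_mem _ (S.sub_mem (hS _) (hS _))

end NormedAlgebra

section Matrix

open scoped Matrix.Norms.Operator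

theorem matrix_exp_mul_mul_exp_neg_mem {S : Submodule ℝ (Matrix n n ℂ)} {X : Matrix n n ℂ}
    (hX : ∀ Y ∈ S, X * Y - Y * X ∈ S) {Y : Matrix n n ℂ} (hY : Y ∈ S) :
    exp X * Y * exp (-X) ∈ S :=
  exp_mul_mul_exp_neg_mem hX hY

theorem matrix_commutator_mem_of_exp_conj_sub_mem {S : Submodule ℝ (Matrix n n ℂ)}
    {X A : Matrix n n ℂ} (hS : ∀ t : ℝ, exp (t • X) * A * exp (-(t • X)) - A ∈ S) :
    X * A - A * X ∈ S :=
  commutator_mem_of_exp_conj_sub_mem hS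

end Matrix

theorem exp_mem_unitaryGroup {X : Matrix n n ℂ} (hX : X.conjTranspose = -X) :
    exp X ∈ Matrix.unitaryGroup n ℂ := by
  rw [Matrix.mem_unitaryGroup_iff, Matrix.star_eq_conjTranspose, ← Matrix.exp_conjTranspose, hX,
    ← Matrix.exp_add_of_commute _ _ (Commute.neg_right (Commute.refl X)), add_neg_cancel, exp_zero]

end Exponential

/-! ### The action of `G` on `i𝔤` -/

variable {g : LieSubalgebra ℝ (Matrix n n ℂ)}

/-- The one-parameter subgroups `exp (tX)`, `X ∈ 𝔤`, lie in `G`. -/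
theorem exp_mem_expGroup (hg : IsSkewHermitianAlgebra g) {X : Matrix n n ℂ} (hX : X ∈ g) :
    (⟨NormedSpace.exp X, exp_mem_unitaryGroup (hg X hX)⟩ : Matrix.unitaryGroup n ℂ) ∈ expGroup g :=
  Subgroup.le_topologicalClosure _ (Subgroup.subset_closure ⟨X, hX, rfl⟩)

theorem conj_exp_mem_iMul {X A : Matrix n n ℂ} (hX : X ∈ g) (hA : A ∈ iMul g.toSubmodule) :
    NormedSpace.exp X * A * NormedSpace.exp (-X) ∈ iMul g.toSubmodule := by
  refine matrix_exp_mul_mul_exp_neg_mem ?_ hA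
  rintro _ ⟨Y, hY, rfl⟩
  rw [mul_smul_comm, smul_mul_assoc, ← smul_sub]
  exact I_smul_mem_iMul (g.lie_mem hX hY)

/-- `G` acts on `i𝔤` by conjugation. -/
theorem conj_mem_iMul (hg : IsSkewHermitianAlgebra g) {u : Matrix.unitaryGroup n ℂ}
    (hu : u ∈ expGroup g) {A : Matrix n n ℂ} (hA : A ∈ iMul g.toSubmodule) :
    (u : Matrix n n ℂ) * A * (u : Matrix n n ℂ).conjTranspose ∈ iMul g.toSubmodule := by
  -- Preserving `i𝔤` is a closed condition on `u`, so it passes from the generated subgroup to its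
  -- closure.
  have hclosed : IsClosed {u : Matrix.unitaryGroup n ℂ | ∀ A ∈ iMul g.toSubmodule,
      (u : Matrix n n ℂ) * A * (u : Matrix n n ℂ).conjTranspose ∈ iMul g.toSubmodule} := by
    rw [Set.ofPred_forall]
    refine isClosed_iInter fun A => ?_
    rw [Set.ofPred_forall]
    refine isClosed_iInter fun _ => ?_
    have hW : IsClosed (iMul g.toSubmodule : Set (Matrix n n ℂ)) :=
      Submodule.closed_of_finiteDimensional _
    refine hW.preimage (f := fun u : Matrix.unitaryGroup n ℂ =>
      (u : Matrix n n ℂ) * A * (u : Matrix n n ℂ).conjTranspose) ?_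
    have h1 : Continuous fun u : Matrix.unitaryGroup n ℂ => (u : Matrix n n ℂ) :=
      continuous_subtype_val
    exact (h1.mul continuous_const).mul h1.matrix_conjTranspose
  have key : ∀ u ∈ Subgroup.closure {u : Matrix.unitaryGroup n ℂ | ∃ X ∈ g,
      (u : Matrix n n ℂ) = NormedSpace.exp X}, ∀ A ∈ iMul g.toSubmodule,
      (u : Matrix n n ℂ) * A * (u : Matrix n n ℂ).conjTranspose ∈ iMul g.toSubmodule := by
    intro u hu
    induction hu using Subgroup.closure_induction'' with
    | one => intro A hA; simpa using hA
    | mem u hu =>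
      obtain ⟨X, hX, hu⟩ := hu
      intro A hA
      rw [hu, ← Matrix.exp_conjTranspose, hg X hX]
      exact conj_exp_mem_iMul hX hA
    | inv_mem u hu =>
      obtain ⟨X, hX, hu⟩ := hu
      intro A hA
      have h1 : ((u⁻¹ : Matrix.unitaryGroup n ℂ) : Matrix n n ℂ) = NormedSpace.exp (-X) := by
        change star (u : Matrix n n ℂ) = _
        rw [hu, Matrix.star_eq_conjTranspose, ← Matrix.exp_conjTranspose, hg X hX]
      rw [h1, ← Matrix.exp_conjTranspose, Matrix.conjTranspose_neg, hg X hX]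
      exact conj_exp_mem_iMul (g.neg_mem hX) hA
    | mul u v _ _ hu hv =>
      intro A hA
      have h1 := hu _ (hv A hA)
      rw [Submonoid.coe_mul, Matrix.conjTranspose_mul]
      simpa only [mul_assoc] using h1
  exact hclosed.closure_subset_iff.2 (fun u hu => key u hu) hu A hA

/-- The action of `G` on `i𝔤` by conjugation. -/
def conjAction (hg : IsSkewHermitianAlgebra g) (u : expGroup g) (A : iMul g.toSubmodule) :
    iMul g.toSubmodule :=
  ⟨_, conj_mem_iMul hg u.2 A.2⟩

theorem coe_conjAction (hg : IsSkewHermitianAlgebra g) (u : expGroup g) (A : iMul g.toSubmodule) :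
    (conjAction hg u A : Matrix n n ℂ) = ((u : Matrix.unitaryGroup n ℂ) : Matrix n n ℂ) * A *
      ((u : Matrix.unitaryGroup n ℂ) : Matrix n n ℂ).conjTranspose :=
  rfl

theorem coe_mul_conjTranspose (u : Matrix.unitaryGroup n ℂ) :
    (u : Matrix n n ℂ) * (u : Matrix n n ℂ).conjTranspose = 1 :=
  Matrix.mem_unitaryGroup_iff.1 u.2

theorem conjTranspose_mul_coe (u : Matrix.unitaryGroup n ℂ) :
    (u : Matrix n n ℂ).conjTranspose * (u : Matrix n n ℂ) = 1 :=
  Matrix.mem_unitaryGroup_iff'.1 u.2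

theorem coe_inv_expGroup (u : expGroup g) :
    (((u⁻¹ : expGroup g) : Matrix.unitaryGroup n ℂ) : Matrix n n ℂ) =
      ((u : Matrix.unitaryGroup n ℂ) : Matrix n n ℂ).conjTranspose :=
  rfl

theorem conjAction_conjAction_inv (hg : IsSkewHermitianAlgebra g) (u : expGroup g)
    (A : iMul g.toSubmodule) : conjAction hg u (conjAction hg u⁻¹ A) = A := by
  apply Subtype.ext
  rw [coe_conjAction, coe_conjAction, coe_inv_expGroup, Matrix.conjTranspose_conjTranspose]
  calc _ = ((u : Matrix.unitaryGroup n ℂ) * (u : Matrix n n ℂ).conjTranspose) * (A : Matrix n n ℂ)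
        * ((u : Matrix.unitaryGroup n ℂ) * (u : Matrix n n ℂ).conjTranspose) := by noncomm_ring
    _ = _ := by rw [coe_mul_conjTranspose, one_mul, mul_one]

theorem trace_conj_mul_conj (u : Matrix.unitaryGroup n ℂ) (A B : Matrix n n ℂ) :
    ((u : Matrix n n ℂ) * A * (u : Matrix n n ℂ).conjTranspose *
      ((u : Matrix n n ℂ) * B * (u : Matrix n n ℂ).conjTranspose)).trace = (A * B).trace := by
  calc _ = ((u : Matrix n n ℂ) * (A * ((u : Matrix n n ℂ).conjTranspose * u) * B *
        (u : Matrix n n ℂ).conjTranspose)).trace := by congr 1; noncomm_ring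
    _ = (A * B).trace := by
      rw [conjTranspose_mul_coe, mul_one, Matrix.trace_mul_comm, mul_assoc, conjTranspose_mul_coe,
        mul_one]

/-- If conjugation by `G` moves `A` only within `S`, then so does the bracket with `𝔤`. -/
theorem commutator_mem_of_conjAction_sub_mem (hg : IsSkewHermitianAlgebra g)
    {S : Submodule ℝ (Matrix n n ℂ)} (A : iMul g.toSubmodule)
    (hS : ∀ u : expGroup g, (conjAction hg u A : Matrix n n ℂ) - A ∈ S) {X : Matrix n n ℂ}
    (hX : X ∈ g) : X * (A : Matrix n n ℂ) - A * X ∈ S := by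
  refine matrix_commutator_mem_of_exp_conj_sub_mem fun t => ?_
  have htX : t • X ∈ g := g.smul_mem t hX
  have h1 := hS ⟨_, exp_mem_expGroup hg htX⟩
  rw [coe_conjAction, ← Matrix.exp_conjTranspose, hg _ htX] at h1
  exact h1

/-- `i𝔤` is an irreducible representation of `G` if `𝔤` is simple. -/
theorem eq_bot_or_eq_top_of_conjAction (hg : IsSkewHermitianAlgebra g)
    (hsimple : LieAlgebra.IsSimple ℝ g) (K : Submodule ℝ (iMul g.toSubmodule))
    (hK : ∀ u, ∀ A ∈ K, conjAction hg u A ∈ K) : K = ⊥ ∨ K = ⊤ := by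
  -- The subspace of `𝔤` that corresponds to `K`; differentiating the action of `G` shows that it is
  -- an ideal.
  let I : LieIdeal ℝ g :=
    { carrier := {x | (⟨_, I_smul_mem_iMul x.2⟩ : iMul g.toSubmodule) ∈ K}
      add_mem' := fun {x y} hx hy => by
        have h1 := K.add_mem hx hy
        rw [AddMemClass.mk_add_mk] at h1
        simp only [← smul_add] at h1
        exact h1
      zero_mem' := by
        have h1 : (⟨_, I_smul_mem_iMul (0 : g).2⟩ : iMul g.toSubmodule) = 0 :=
          Subtype.ext (smul_zero _)
        rw [Set.mem_ofPred_eq, h1]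
        exact K.zero_mem
      smul_mem' := fun c x hx => by
        have h1 := K.smul_mem c hx
        rw [SetLike.mk_smul_mk] at h1
        simp only [smul_comm c Complex.I] at h1
        exact h1
      lie_mem := fun {x y} hy => by
        have h1 := commutator_mem_of_conjAction_sub_mem hg (S := K.map (Submodule.subtype _))
          ⟨_, I_smul_mem_iMul y.2⟩
          (fun u => ⟨_, K.sub_mem (hK u _ hy) hy, rfl⟩) x.2
        obtain ⟨z, hz, hz'⟩ := h1
        have h2 : (z : Matrix n n ℂ) = Complex.I • (⁅x, y⁆ : g) := by
          change (z : Matrix n n ℂ) = _ at hz'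
          rw [hz', LieSubalgebra.coe_bracket, Ring.lie_def, smul_sub, mul_smul_comm, smul_mul_assoc]
        have h3 : z = ⟨_, I_smul_mem_iMul (⁅x, y⁆ : g).2⟩ := Subtype.ext h2
        rw [h3] at hz
        exact hz }
  rcases hsimple.eq_bot_or_eq_top I with hI | hI
  · left
    rw [eq_bot_iff]
    rintro ⟨_, X, hX, rfl⟩ hXK
    have h1 : (⟨X, hX⟩ : g) ∈ I := hXK
    rw [hI, LieSubmodule.mem_bot] at h1
    have h2 : X = 0 := congrArg Subtype.val h1
    subst h2
    rw [Submodule.mem_bot]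
    exact Subtype.ext (smul_zero _)
  · right
    rw [eq_top_iff]
    rintro ⟨_, X, hX, rfl⟩ -
    have h1 : (⟨X, hX⟩ : g) ∈ I := hI ▸ LieSubmodule.mem_top _
    exact h1

end

section

/-! ### Riesz representation and Parseval's identity -/

theorem exists_forall_eq_inner {W : Type*} [AddCommGroup W] [Module ℝ W] [FiniteDimensional ℝ W]
    (c : InnerProductSpace.Core ℝ W) (f : W →ₗ[ℝ] ℝ) : ∃ p, ∀ w, f w = c.inner p w := by
  let : NormedAddCommGroup W := c.toNormedAddCommGroup
  let : InnerProductSpace ℝ W := InnerProductSpace.ofCore c.toCore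
  have : CompleteSpace W := FiniteDimensional.complete ℝ W
  refine ⟨(InnerProductSpace.toDual ℝ W).symm (LinearMap.toContinuousLinearMap f), fun w => ?_⟩
  exact (InnerProductSpace.toDual_symm_apply (𝕜 := ℝ) (x := w)
    (y := LinearMap.toContinuousLinearMap f)).symm

theorem exists_orthonormal_basis {W : Type*} [AddCommGroup W] [Module ℝ W] [FiniteDimensional ℝ W]
    (c : InnerProductSpace.Core ℝ W) :
    ∃ e : Module.Basis (Fin (Module.finrank ℝ W)) ℝ W,
      (∀ i j, c.inner (e i) (e j) = if i = j then 1 else 0) ∧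
        ∀ p, ∑ i, c.inner p (e i) ^ 2 = c.inner p p := by
  let : NormedAddCommGroup W := c.toNormedAddCommGroup
  let : InnerProductSpace ℝ W := InnerProductSpace.ofCore c.toCore
  let e := stdOrthonormalBasis ℝ W
  refine ⟨e.toBasis, fun i j => ?_, fun p => ?_⟩
  · rw [e.coe_toBasis]
    exact orthonormal_iff_ite.1 e.orthonormal i j
  · rw [e.coe_toBasis]
    have h1 := e.sum_sq_norm_inner_left p
    have h2 : ‖p‖ ^ 2 = c.inner p p := (real_inner_self_eq_norm_sq p).symm
    rw [← h2, ← h1]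
    refine Finset.sum_congr rfl fun i _ => ?_
    rw [Real.norm_eq_abs, sq_abs]

variable {n : Type*} [Fintype n] [DecidableEq n]

/-! ### Integrals over random unitaries -/

/-- The unitary group is compact, so a continuous function of `U θ` is bounded. -/
theorem integrable_comp_unitary {Θ : Type*} [MeasurableSpace Θ] (P : Measure Θ) [IsFiniteMeasure P]
    {U : Θ → Matrix.unitaryGroup n ℂ} (hU : ∀ i j, Measurable fun θ => (U θ : Matrix n n ℂ) i j)
    {F : Type*} [NormedAddCommGroup F] [MeasurableSpace F] [BorelSpace F]
    [SecondCountableTopology F] (f : Matrix n n ℂ → F) (hf : Continuous f) :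
    Integrable (fun θ => f (U θ)) P := by
  have h1 : Measurable fun θ => (fun i j => (U θ : Matrix n n ℂ) i j : n → n → ℂ) :=
    measurable_pi_iff.2 fun i => measurable_pi_iff.2 fun j => hU i j
  have hf' : Continuous (fun A : n → n → ℂ => f (Matrix.of A)) := hf
  have h2 : Measurable fun θ => f (U θ) := hf'.measurable.comp h1
  obtain ⟨C, hC⟩ : ∃ C, ∀ u : Matrix.unitaryGroup n ℂ, ‖f u‖ ≤ C := by
    have h3 : IsCompact (Set.range fun u : Matrix.unitaryGroup n ℂ => f (u : Matrix n n ℂ)) :=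
      isCompact_range (hf.comp continuous_subtype_val)
    obtain ⟨C, hC⟩ := h3.isBounded.exists_norm_le
    exact ⟨C, fun u => hC _ ⟨u, rfl⟩⟩
  exact Integrable.of_bound h2.aestronglyMeasurable C (Filter.Eventually.of_forall fun θ => hC _)

/-! ### Second moments through tensor squares -/

/-- The tensor product `A ⊗ B`, indexed by pairs in the form of functions on `Fin 2`. -/
def tensorMul (A B : Matrix n n ℂ) : Matrix (Fin 2 → n) (Fin 2 → n) ℂ :=
  Matrix.of fun i j => A (i 0) (j 0) * B (i 1) (j 1)

theorem sum_fin_two_arrow (f : n → ℂ) (k : n → ℂ) :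
    ∑ i : Fin 2 → n, f (i 0) * k (i 1) = (∑ i, f i) * ∑ i, k i := by
  rw [Finset.sum_mul_sum, ← Fintype.sum_prod_type' (f := fun i j => f i * k j)]
  exact Fintype.sum_equiv (finTwoArrowEquiv n) _ _ fun i => rfl

theorem tensorMul_mul (A B C D : Matrix n n ℂ) :
    tensorMul A B * tensorMul C D = tensorMul (A * C) (B * D) := by
  ext i j
  simp only [Matrix.mul_apply, tensorMul, Matrix.of_apply]
  rw [← sum_fin_two_arrow]
  exact Finset.sum_congr rfl fun k _ => by ring

theorem trace_tensorMul (A B : Matrix n n ℂ) : (tensorMul A B).trace = A.trace * B.trace :=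
  sum_fin_two_arrow (fun i => A i i) fun i => B i i

theorem tensorPow_two (A : Matrix n n ℂ) : tensorPow 2 A = tensorMul A A := by
  ext i j
  simp [tensorPow, tensorMul, Fin.prod_univ_two]

theorem conjTranspose_tensorMul (A B : Matrix n n ℂ) :
    (tensorMul A B).conjTranspose = tensorMul A.conjTranspose B.conjTranspose := by
  ext i j
  simp [tensorMul, Matrix.conjTranspose_apply]

theorem continuous_tensorMul_self : Continuous fun A : Matrix n n ℂ => tensorMul A A :=
  continuous_matrix fun i j =>
    (continuous_id.matrix_elem (i 0) (j 0)).mul (continuous_id.matrix_elem (i 1) (j 1))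

/-- Second moments of matrix coefficients are determined by the second moment operator. -/
theorem integral_trace_mul_trace {Θ : Type*} [MeasurableSpace Θ] (P : Measure Θ)
    [IsFiniteMeasure P] {U : Θ → Matrix.unitaryGroup n ℂ}
    (hU : ∀ i j, Measurable fun θ => (U θ : Matrix n n ℂ) i j) (A B C D : Matrix n n ℂ) :
    ∫ θ, ((U θ : Matrix n n ℂ) * A * (U θ : Matrix n n ℂ).conjTranspose * C).trace *
      ((U θ : Matrix n n ℂ) * B * (U θ : Matrix n n ℂ).conjTranspose * D).trace ∂P =
    (momentOperator P U 2 (tensorMul A B) * tensorMul C D).trace := by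
  have h1 : ∀ V : Matrix n n ℂ, (V * A * V.conjTranspose * C).trace *
      (V * B * V.conjTranspose * D).trace = ∑ i, ∑ j,
        (tensorPow 2 V * tensorMul A B * (tensorPow 2 V).conjTranspose) i j *
          tensorMul C D j i := by
    intro V
    rw [← trace_tensorMul, ← tensorMul_mul, ← tensorMul_mul, ← tensorMul_mul,
      ← conjTranspose_tensorMul, tensorPow_two]
    rfl
  have hcont : ∀ i j, Continuous fun V : Matrix n n ℂ =>
      (tensorPow 2 V * tensorMul A B * (tensorPow 2 V).conjTranspose) i j := by
    intro i j
    simp only [tensorPow_two]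
    exact ((continuous_tensorMul_self.matrix_mul continuous_const).matrix_mul
      continuous_tensorMul_self.matrix_conjTranspose).matrix_elem i j
  have hint : ∀ i j, Integrable (fun θ => (tensorPow 2 (U θ : Matrix n n ℂ) * tensorMul A B *
      (tensorPow 2 (U θ : Matrix n n ℂ)).conjTranspose) i j * tensorMul C D j i) P := fun i j =>
    (integrable_comp_unitary P hU _ (hcont i j)).mul_const _
  simp only [h1]
  rw [integral_finsetSum _ fun i _ => integrable_finsetSum _ fun j _ => hint i j]
  refine Finset.sum_congr rfl fun i _ => ?_
  rw [integral_finsetSum _ fun j _ => hint i j]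
  refine Finset.sum_congr rfl fun j _ => ?_
  rw [integral_mul_const]
  simp only [momentOperator, Matrix.of_apply, tensorPow_two, conjTranspose_tensorMul]

/-! ### The variance over a design -/

theorem trace_mul_eq_ofReal {A B : Matrix n n ℂ} (hA : A.IsHermitian) (hB : B.IsHermitian) :
    (A * B).trace = ((A * B).trace.re : ℂ) := by
  refine (Complex.conj_eq_iff_re.1 ?_).symm
  rw [← Complex.star_def, ← Matrix.trace_conjTranspose, Matrix.conjTranspose_mul, hA, hB,
    Matrix.trace_mul_comm]

theorem isHermitian_conj {A : Matrix n n ℂ} (hA : A.IsHermitian) (V : Matrix n n ℂ) :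
    (V * A * V.conjTranspose).IsHermitian := by
  rw [Matrix.IsHermitian, Matrix.conjTranspose_mul, Matrix.conjTranspose_mul,
    Matrix.conjTranspose_conjTranspose, hA, mul_assoc]

theorem continuous_lossFun (ρ O : Matrix n n ℂ) :
    Continuous fun V : Matrix n n ℂ => (V * ρ * V.conjTranspose * O).trace.re := by
  refine Complex.continuous_re.comp (Continuous.matrix_trace ?_)
  exact ((continuous_id.matrix_mul continuous_const).matrix_mul
    continuous_id.matrix_conjTranspose).matrix_mul continuous_const

theorem lossVariance_eq {Θ : Type*} [MeasurableSpace Θ] (P : Measure Θ)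
    [IsProbabilityMeasure P] {U : Θ → Matrix.unitaryGroup n ℂ}
    (hU : ∀ i j, Measurable fun θ => (U θ : Matrix n n ℂ) i j) (ρ O : Matrix n n ℂ) :
    lossVariance P U ρ O = ∫ θ, loss ρ O (U θ) ^ 2 ∂P - (∫ θ, loss ρ O (U θ) ∂P) ^ 2 := by
  have hc := continuous_lossFun ρ O
  have h1 : Integrable (fun θ => loss ρ O (U θ)) P := integrable_comp_unitary P hU _ hc
  have h2 : Integrable (fun θ => loss ρ O (U θ) ^ 2) P :=
    integrable_comp_unitary P hU _ (hc.pow 2)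
  exact variance_eq_sub ((memLp_two_iff_integrable_sq h1.aestronglyMeasurable).2 h2)

instance isProbabilityMeasure_haarG (g : LieSubalgebra ℝ (Matrix n n ℂ)) :
    IsProbabilityMeasure (haarG g) :=
  ⟨Measure.haarMeasure_self⟩

instance isMulLeftInvariant_haarG (g : LieSubalgebra ℝ (Matrix n n ℂ)) :
    (haarG g).IsMulLeftInvariant :=
  Measure.isMulLeftInvariant_haarMeasure _

theorem measurable_coe_expGroup (g : LieSubalgebra ℝ (Matrix n n ℂ)) (i j : n) :
    Measurable fun u : expGroup g => ((u : Matrix.unitaryGroup n ℂ) : Matrix n n ℂ) i j :=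
  ((continuous_subtype_val.comp continuous_subtype_val).matrix_elem i j).measurable

/-- The variance over a 2-design is the variance over the group. -/
theorem lossVariance_eq_haarG [Nonempty n] {g : LieSubalgebra ℝ (Matrix n n ℂ)} {Θ : Type*}
    [MeasurableSpace Θ] (P : Measure Θ) [IsProbabilityMeasure P] {U : Θ → Matrix.unitaryGroup n ℂ}
    (hU : ∀ i j, Measurable fun θ => (U θ : Matrix n n ℂ) i j) (hdes : IsDesign g P U 2)
    {ρ O : Matrix n n ℂ} (hρ : ρ.IsHermitian) (hO : O.IsHermitian) :
    lossVariance P U ρ O =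
      lossVariance (haarG g) (fun u => (u : Matrix.unitaryGroup n ℂ)) ρ O := by
  have hmom : ∀ A B C D : Matrix n n ℂ,
      ∫ θ, ((U θ : Matrix n n ℂ) * A * (U θ : Matrix n n ℂ).conjTranspose * C).trace *
        ((U θ : Matrix n n ℂ) * B * (U θ : Matrix n n ℂ).conjTranspose * D).trace ∂P =
      ∫ u : expGroup g, (((u : Matrix.unitaryGroup n ℂ) : Matrix n n ℂ) * A *
        ((u : Matrix.unitaryGroup n ℂ) : Matrix n n ℂ).conjTranspose * C).trace *
        (((u : Matrix.unitaryGroup n ℂ) : Matrix n n ℂ) * B *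
        ((u : Matrix.unitaryGroup n ℂ) : Matrix n n ℂ).conjTranspose * D).trace ∂(haarG g) := by
    intro A B C D
    rw [integral_trace_mul_trace P hU, integral_trace_mul_trace (haarG g)
      (measurable_coe_expGroup g), hdes]
  have hloss : ∀ V : Matrix.unitaryGroup n ℂ,
      ((V : Matrix n n ℂ) * ρ * (V : Matrix n n ℂ).conjTranspose * O).trace = (loss ρ O V : ℂ) :=
    fun V => trace_mul_eq_ofReal (isHermitian_conj hρ _) hO
  -- The constant `Tr[V 1 V† 1] = N` as second factor turns a first moment into a second one; `N ≠
  -- 0` is cancelled below.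
  have hone : ∀ V : Matrix.unitaryGroup n ℂ,
      ((V : Matrix n n ℂ) * 1 * (V : Matrix n n ℂ).conjTranspose * 1).trace =
        ((Fintype.card n : ℝ) : ℂ) := by
    intro V
    rw [mul_one, mul_one, coe_mul_conjTranspose, Matrix.trace_one]
    simp
  have hsq : ∫ θ, loss ρ O (U θ) ^ 2 ∂P = ∫ u : expGroup g, loss ρ O u ^ 2 ∂(haarG g) := by
    have h1 := hmom ρ ρ O O
    simp only [hloss, ← pow_two] at h1
    exact_mod_cast h1
  have hmean : ∫ θ, loss ρ O (U θ) ∂P = ∫ u : expGroup g, loss ρ O u ∂(haarG g) := by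
    have h1 := hmom ρ 1 O 1
    simp only [hloss, hone, ← Complex.ofReal_mul, integral_complex_ofReal, integral_mul_const] at h1
    have h2 := Complex.ofReal_injective h1
    exact mul_right_cancel₀ (Nat.cast_ne_zero.2 Fintype.card_ne_zero) h2
  rw [lossVariance_eq P hU, lossVariance_eq (haarG g) (measurable_coe_expGroup g), hsq, hmean]

/-! ### The variance over the group -/

variable {g : LieSubalgebra ℝ (Matrix n n ℂ)}

/-- The functional `w ↦ Tr[u ρ u† w]` on `i𝔤`. -/
noncomputable def lossFunctional (g : LieSubalgebra ℝ (Matrix n n ℂ)) (ρ : Matrix n n ℂ)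
    (u : Matrix.unitaryGroup n ℂ) : iMul g.toSubmodule →ₗ[ℝ] ℝ where
  toFun w := loss ρ w u
  map_add' v w := by simp [loss, mul_add]
  map_smul' c w := by simp [loss]

/-- Cyclicity of the trace moves the conjugation from the observable to a left translation of `u`,
which Haar measure ignores. -/
theorem lossFunctional_conjAction (hg : IsSkewHermitianAlgebra g) (ρ : Matrix n n ℂ)
    (s u : expGroup g) (w : iMul g.toSubmodule) :
    lossFunctional g ρ u (conjAction hg s w) = lossFunctional g ρ (s⁻¹ * u : expGroup g) w := by
  change (_ * ((s : Matrix.unitaryGroup n ℂ) * (w : Matrix n n ℂ) *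
    ((s : Matrix.unitaryGroup n ℂ) : Matrix n n ℂ).conjTranspose)).trace.re = (((
      ((s : Matrix.unitaryGroup n ℂ) : Matrix n n ℂ).conjTranspose * (u : Matrix.unitaryGroup n ℂ)) *
      ρ * (((s : Matrix.unitaryGroup n ℂ) : Matrix n n ℂ).conjTranspose *
        (u : Matrix.unitaryGroup n ℂ)).conjTranspose) * (w : Matrix n n ℂ)).trace.re
  rw [← mul_assoc, Matrix.trace_mul_comm, Matrix.conjTranspose_mul,
    Matrix.conjTranspose_conjTranspose]
  simp only [mul_assoc]

theorem lossFunctional_inv (hg : IsSkewHermitianAlgebra g) (ρ : Matrix n n ℂ)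
    (u : expGroup g) (w : iMul g.toSubmodule) :
    lossFunctional g ρ u w = lossFunctional g ρ 1 (conjAction hg u⁻¹ w) := by
  have h1 := lossFunctional_conjAction hg ρ u⁻¹ 1 w
  rw [inv_inv, mul_one] at h1
  exact h1.symm

theorem integrable_lossFunctional (ρ : Matrix n n ℂ) (w : iMul g.toSubmodule) :
    Integrable (fun u : expGroup g => lossFunctional g ρ u w) (haarG g) :=
  integrable_comp_unitary (haarG g) (measurable_coe_expGroup g)
    (fun V => (V * ρ * V.conjTranspose * (w : Matrix n n ℂ)).trace.re) (continuous_lossFun ρ w)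

theorem integrable_lossFunctional_mul (ρ : Matrix n n ℂ) (v w : iMul g.toSubmodule) :
    Integrable (fun u : expGroup g => lossFunctional g ρ u v * lossFunctional g ρ u w) (haarG g) :=
  integrable_comp_unitary (haarG g) (measurable_coe_expGroup g)
    (fun V => (V * ρ * V.conjTranspose * (v : Matrix n n ℂ)).trace.re *
      (V * ρ * V.conjTranspose * (w : Matrix n n ℂ)).trace.re)
    ((continuous_lossFun ρ v).mul (continuous_lossFun ρ w))

/-- The mean of the loss over the group vanishes. -/
theorem integral_lossFunctional (hg : IsSkewHermitianAlgebra g)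
    (hsimple : LieAlgebra.IsSimple ℝ g) (ρ : Matrix n n ℂ) (w : iMul g.toSubmodule) :
    ∫ u : expGroup g, lossFunctional g ρ u w ∂(haarG g) = 0 := by
  let m : iMul g.toSubmodule →ₗ[ℝ] ℝ :=
    { toFun := fun w => ∫ u : expGroup g, lossFunctional g ρ u w ∂(haarG g)
      map_add' := fun v w => by
        simp only [map_add]
        exact integral_add (integrable_lossFunctional ρ v) (integrable_lossFunctional ρ w)
      map_smul' := fun c w => by
        simp only [map_smul, smul_eq_mul, RingHom.id_apply]
        exact integral_const_mul _ _ }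
  have hm : ∀ s w, m (conjAction hg s w) = m w := by
    intro s w
    change ∫ u : expGroup g, lossFunctional g ρ u (conjAction hg s w) ∂(haarG g) = _
    simp only [lossFunctional_conjAction]
    exact integral_mul_left_eq_self (fun u : expGroup g => lossFunctional g ρ u w) s⁻¹
  rcases eq_bot_or_eq_top_of_conjAction hg hsimple (LinearMap.ker m) (fun s w hw => by
    rw [LinearMap.mem_ker] at hw ⊢
    rw [hm, hw]) with hker | hker
  -- If `m` were injective, `m (s·w - w) = 0` would make `G` act trivially, and `𝔤` would be
  -- abelian.
  · refine absurd ⟨fun x y => ?_⟩ hsimple.non_abelian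
    have hfix : ∀ s w, conjAction hg s w = w := by
      intro s w
      have h1 : conjAction hg s w - w ∈ LinearMap.ker m := by
        rw [LinearMap.mem_ker, map_sub, hm, sub_self]
      rw [hker, Submodule.mem_bot, sub_eq_zero] at h1
      exact h1
    have h1 := commutator_mem_of_conjAction_sub_mem hg (S := ⊥) ⟨_, I_smul_mem_iMul y.2⟩
      (fun s => by rw [hfix, sub_self]; exact Submodule.zero_mem _) x.2
    rw [Submodule.mem_bot, mul_smul_comm, smul_mul_assoc, ← smul_sub] at h1
    have h2 := (smul_eq_zero.1 h1).resolve_left Complex.I_ne_zero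
    apply Subtype.ext
    rw [LieSubalgebra.coe_bracket, Ring.lie_def, h2]
    rfl
  · have h1 : w ∈ LinearMap.ker m := hker ▸ Submodule.mem_top
    exact h1

theorem finrank_iMul (g : LieSubalgebra ℝ (Matrix n n ℂ)) :
    Module.finrank ℝ (iMul g.toSubmodule) = Module.finrank ℝ g := by
  let f : g →ₗ[ℝ] iMul g.toSubmodule :=
    { toFun := fun x => ⟨_, I_smul_mem_iMul x.2⟩
      map_add' := fun x y => Subtype.ext (smul_add _ _ _)
      map_smul' := fun c x => Subtype.ext (smul_comm _ _ _) }
  refine (LinearEquiv.finrank_eq (LinearEquiv.ofBijective f ⟨fun x y hxy => ?_, ?_⟩)).symm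
  · have h1 : Complex.I • (x : Matrix n n ℂ) = Complex.I • (y : Matrix n n ℂ) :=
      congrArg Subtype.val hxy
    exact Subtype.ext (smul_right_injective _ Complex.I_ne_zero h1)
  · rintro ⟨_, X, hX, rfl⟩
    exact ⟨⟨X, hX⟩, rfl⟩

theorem nontrivial_iMul (hsimple : LieAlgebra.IsSimple ℝ g) : Nontrivial (iMul g.toSubmodule) := by
  by_contra hnt
  rw [not_nontrivial_iff_subsingleton] at hnt
  refine hsimple.non_abelian ⟨fun x y => ?_⟩
  have h1 : (⟨_, I_smul_mem_iMul (⁅x, y⁆ : g).2⟩ : iMul g.toSubmodule) = 0 := Subsingleton.elim _ _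
  have h2 : Complex.I • ((⁅x, y⁆ : g) : Matrix n n ℂ) = 0 := congrArg Subtype.val h1
  exact Subtype.ext ((smul_eq_zero.1 h2).resolve_left Complex.I_ne_zero)

theorem hsCoreReal_inner (hg : IsSkewHermitianAlgebra g) (a b : iMul g.toSubmodule) :
    (hsCoreReal (iMul g.toSubmodule)).inner a b = ((a : Matrix n n ℂ) * (b : Matrix n n ℂ)).trace.re := by
  change ((a : Matrix n n ℂ).conjTranspose * (b : Matrix n n ℂ)).trace.re = _
  rw [isHermitian_of_mem_iMul hg a.2]

theorem hsCoreReal_inner_conjAction (hg : IsSkewHermitianAlgebra g) (s : expGroup g)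
    (a b : iMul g.toSubmodule) :
    (hsCoreReal (iMul g.toSubmodule)).inner (conjAction hg s a) (conjAction hg s b) =
      (hsCoreReal (iMul g.toSubmodule)).inner a b := by
  rw [hsCoreReal_inner hg, hsCoreReal_inner hg, coe_conjAction, coe_conjAction,
    trace_conj_mul_conj]

/-- The orthogonal projection of `ρ` to `i𝔤`. -/
theorem exists_projection (hg : IsSkewHermitianAlgebra g) (ρ : Matrix n n ℂ) :
    ∃ p : iMul g.toSubmodule, ∀ w : iMul g.toSubmodule,
      (ρ * (w : Matrix n n ℂ)).trace.re = ((p : Matrix n n ℂ) * (w : Matrix n n ℂ)).trace.re := by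
  obtain ⟨p, hp⟩ := exists_forall_eq_inner (hsCoreReal (iMul g.toSubmodule))
    (lossFunctional g ρ 1)
  refine ⟨p, fun w => ?_⟩
  have h1 := hp w
  rw [hsCoreReal_inner hg] at h1
  rw [← h1]
  change _ = (1 * ρ * (1 : Matrix n n ℂ).conjTranspose * (w : Matrix n n ℂ)).trace.re
  rw [one_mul, Matrix.conjTranspose_one, mul_one]

/-- The variance of the loss over the group, for an observable in `i𝔤`. -/
theorem lossVariance_haarG (hg : IsSkewHermitianAlgebra g) (hsimple : LieAlgebra.IsSimple ℝ g)
    (ρ : Matrix n n ℂ) (p : iMul g.toSubmodule)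
    (hp : ∀ w : iMul g.toSubmodule,
      (ρ * (w : Matrix n n ℂ)).trace.re = ((p : Matrix n n ℂ) * (w : Matrix n n ℂ)).trace.re)
    (O : iMul g.toSubmodule) :
    lossVariance (haarG g) (fun u => (u : Matrix.unitaryGroup n ℂ)) ρ O =
      ((O : Matrix n n ℂ) ^ 2).trace.re / (Module.finrank ℝ g : ℝ) *
        ((p : Matrix n n ℂ) * (p : Matrix n n ℂ)).trace.re := by
  have := nontrivial_iMul hsimple
  set c := hsCoreReal (iMul g.toSubmodule) with hc
  have hone : ∀ w, lossFunctional g ρ 1 w = c.inner p w := by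
    intro w
    rw [hsCoreReal_inner hg, ← hp]
    change (1 * ρ * (1 : Matrix n n ℂ).conjTranspose * (w : Matrix n n ℂ)).trace.re = _
    rw [one_mul, Matrix.conjTranspose_one, mul_one]
  have hu : ∀ (u : expGroup g) w, lossFunctional g ρ u w = c.inner (conjAction hg u p) w := by
    intro u w
    rw [lossFunctional_inv hg, hone, ← hsCoreReal_inner_conjAction hg u, conjAction_conjAction_inv]
  -- The second moment form. Left invariance of Haar measure makes it `G`-invariant, so Schur's
  -- lemma applies.
  let Q : iMul g.toSubmodule →ₗ[ℝ] iMul g.toSubmodule →ₗ[ℝ] ℝ := LinearMap.mk₂ ℝ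
    (fun v w => ∫ u : expGroup g, lossFunctional g ρ u v * lossFunctional g ρ u w ∂(haarG g))
    (fun v v' w => by
      simp only [map_add, add_mul]
      exact integral_add (integrable_lossFunctional_mul ρ v w)
        (integrable_lossFunctional_mul ρ v' w))
    (fun a v w => by
      simp only [map_smul, smul_eq_mul, mul_assoc]
      exact integral_const_mul _ _)
    (fun v w w' => by
      simp only [map_add, mul_add]
      exact integral_add (integrable_lossFunctional_mul ρ v w)
        (integrable_lossFunctional_mul ρ v w'))
    (fun a v w => by
      simp only [map_smul, smul_eq_mul, mul_left_comm _ a]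
      exact integral_const_mul _ _)
  obtain ⟨k, hk⟩ := exists_eq_mul_inner_of_invariant c Q
    (fun a b => integral_congr_ae (Filter.Eventually.of_forall fun u => mul_comm _ _))
    (conjAction hg) (fun u => conjAction hg u⁻¹) (conjAction_conjAction_inv hg)
    (eq_bot_or_eq_top_of_conjAction hg hsimple)
    (fun s a b => by
      change ∫ u : expGroup g, lossFunctional g ρ u (conjAction hg s a) *
        lossFunctional g ρ u (conjAction hg s b) ∂(haarG g) = _
      simp only [lossFunctional_conjAction]
      exact integral_mul_left_eq_self
        (fun u : expGroup g => lossFunctional g ρ u a * lossFunctional g ρ u b) s⁻¹)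
    (hsCoreReal_inner_conjAction hg)
  -- The constant `k` comes from the trace of `Q`: it is `k dim 𝔤`, and by Parseval also the
  -- integral of `‖u p u†‖² = ‖p‖²`.
  obtain ⟨e, he, hpars⟩ := exists_orthonormal_basis c
  have hdim : k * Module.finrank ℝ g = c.inner p p := by
    have h1 : ∑ i, Q (e i) (e i) = k * Module.finrank ℝ g := by
      simp only [hk, he, if_true, mul_one, Finset.sum_const, Finset.card_univ, Fintype.card_fin,
        nsmul_eq_mul, finrank_iMul]
      exact mul_comm _ _
    have h2 : ∑ i, Q (e i) (e i) = c.inner p p := by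
      change ∑ i, ∫ u : expGroup g, lossFunctional g ρ u (e i) * lossFunctional g ρ u (e i)
        ∂(haarG g) = _
      rw [← integral_finsetSum _ fun i _ => integrable_lossFunctional_mul ρ (e i) (e i)]
      simp only [hu, ← pow_two, hpars]
      rw [integral_congr_ae (Filter.Eventually.of_forall fun u =>
        hsCoreReal_inner_conjAction hg u p p)]
      simp
    rw [← h1, h2]
  have hdim0 : (Module.finrank ℝ g : ℝ) ≠ 0 := by
    rw [← finrank_iMul]
    exact Nat.cast_ne_zero.2 Module.finrank_pos.ne'
  have hmean : ∫ u : expGroup g, loss ρ O u ∂(haarG g) = 0 :=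
    integral_lossFunctional hg hsimple ρ O
  have hsq : ∫ u : expGroup g, loss ρ O u ^ 2 ∂(haarG g) = k * c.inner O O := by
    rw [← hk]
    exact integral_congr_ae (Filter.Eventually.of_forall fun u => pow_two _)
  rw [lossVariance_eq (haarG g) (measurable_coe_expGroup g), hmean, hsq, ← hsCoreReal_inner hg,
    ← hdim, hsCoreReal_inner hg, ← pow_two]
  field_simp
  ring

end

section

variable {n : Type*} [Fintype n] [DecidableEq n]
variable {g : LieSubalgebra ℝ (Matrix n n ℂ)} {h : LieSubalgebra ℝ g}

/-! ### Weight states -/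

theorem trace_ketbra_mul (v : EuclideanSpace ℂ n) (A : Matrix n n ℂ) :
    (ketbra v * A).trace = star v.ofLp ⬝ᵥ A.mulVec v.ofLp := by
  rw [ketbra, Matrix.vecMulVec_mul, Matrix.trace_vecMulVec, dotProduct_comm,
    Matrix.dotProduct_mulVec]

theorem star_dotProduct_self_of_norm_eq_one {v : EuclideanSpace ℂ n} (hv : ‖v‖ = 1) :
    star v.ofLp ⬝ᵥ v.ofLp = 1 := by
  have h1 : inner ℂ v v = 1 := by
    rw [inner_self_eq_norm_sq_to_K, hv]; simp
  rw [EuclideanSpace.inner_eq_star_dotProduct, dotProduct_comm] at h1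
  exact h1

theorem trace_ketbra {v : EuclideanSpace ℂ n} (hv : ‖v‖ = 1) : (ketbra v).trace = 1 := by
  rw [← mul_one (ketbra v), trace_ketbra_mul, Matrix.one_mulVec,
    star_dotProduct_self_of_norm_eq_one hv]

theorem HasWeight.commute_ketbra (hg : IsSkewHermitianAlgebra g)
    {lam : Module.Dual ℝ (iCartan h)} {v : EuclideanSpace ℂ n} (hv : HasWeight h lam v)
    (H : iCartan h) : Commute (ketbra v) (H : Matrix n n ℂ) := by
  have hH : (H : Matrix n n ℂ).IsHermitian := isHermitian_of_mem_iMul hg (iCartan_le h H.2)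
  have h1 : Matrix.vecMul (star v.ofLp) (H : Matrix n n ℂ) = ((lam H : ℝ) : ℂ) • star v.ofLp := by
    have h2 := congrArg star (hv H)
    rw [Matrix.star_mulVec, hH.eq, star_smul, Complex.star_def, Complex.conj_ofReal] at h2
    exact h2
  rw [Commute, SemiconjBy, ketbra, Matrix.vecMulVec_mul, Matrix.mul_vecMulVec, hv H, h1,
    Matrix.vecMulVec_smul, Matrix.smul_vecMulVec]

theorem mem_weightStates_iff {ρ : Matrix n n ℂ} :
    ρ ∈ weightStates h ↔
      ρ.PosSemidef ∧ ρ.trace = 1 ∧ ∀ H ∈ iCartan h, Commute ρ H := by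
  refine and_congr_right fun _ => and_congr_right fun _ => ⟨fun hc => ?_, fun hc X hX => ?_⟩
  · rintro _ ⟨X, hX, rfl⟩
    have h1 := hc X hX
    rw [Ring.lie_def, sub_eq_zero] at h1
    exact Commute.smul_right h1 _
  · have h1 := (hc _ (I_smul_mem_iMul hX)).smul_right (-Complex.I)
    rw [smul_smul, neg_mul, Complex.I_mul_I, neg_neg, one_smul] at h1
    rw [Ring.lie_def, h1.eq, sub_self]

theorem IsWeightDecomposition.mem_weightStates (hg : IsSkewHermitianAlgebra g)
    {ρ : Matrix n n ℂ} {b : OrthonormalBasis n ℂ (EuclideanSpace ℂ n)}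
    {lam : n → Module.Dual ℝ (iCartan h)} {r : n → ℝ} (hρ : IsWeightDecomposition h ρ b lam r) :
    ρ ∈ weightStates h := by
  refine mem_weightStates_iff.2 ⟨?_, ?_, fun H hH => ?_⟩
  · rw [hρ.eq_sum]
    refine Matrix.posSemidef_sum _ fun v _ => ?_
    exact (Matrix.posSemidef_vecMulVec_self_star _).smul
      (Complex.zero_le_real.2 (hρ.nonneg v))
  · rw [hρ.eq_sum, Matrix.trace_sum]
    simp only [Matrix.trace_smul, trace_ketbra (b.orthonormal.1 _), smul_eq_mul, mul_one]
    rw [← Complex.ofReal_sum, hρ.sum_eq_one, Complex.ofReal_one]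
  · rw [hρ.eq_sum]
    exact Commute.sum_left _ _ _ fun v _ => ((hρ.weight v).commute_ketbra hg ⟨H, hH⟩).smul_left _

theorem ketbra_mulVec (v : EuclideanSpace ℂ n) (x : n → ℂ) :
    (ketbra v).mulVec x = (star v.ofLp ⬝ᵥ x) • v.ofLp := by
  rw [ketbra, Matrix.vecMulVec_mulVec]
  ext i
  simp [mul_comm]

theorem exists_isWeightDecomposition (hg : IsSkewHermitianAlgebra g)
    (hh : h.IsCartanSubalgebra) {ρ : Matrix n n ℂ} (hρ : ρ ∈ weightStates h) :
    ∃ b lam r, IsWeightDecomposition h ρ b lam r := by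
  obtain ⟨hpos, htr, hc⟩ := mem_weightStates_iff.1 hρ
  obtain ⟨b, lam, r, hw, hr⟩ := exists_weight_basis hg hh hpos.isHermitian hc
  have hnorm : ∀ v, star (b v).ofLp ⬝ᵥ (b v).ofLp = 1 := fun v =>
    star_dotProduct_self_of_norm_eq_one (b.orthonormal.1 v)
  have hr0 : ∀ v, 0 ≤ r v := by
    intro v
    have h1 := hpos.dotProduct_mulVec_nonneg (b v).ofLp
    rwa [hr, dotProduct_smul, hnorm, smul_eq_mul, mul_one] at h1
  have hre : ∀ v, ((r v).re : ℂ) = r v := fun v =>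
    Complex.ext (Complex.ofReal_re _) ((Complex.le_def.1 (hr0 v)).2)
  have hsum : ρ = ∑ v, ((r v).re : ℂ) • ketbra (b v) := by
    have h1 : Matrix.toEuclideanLin ρ =
        Matrix.toEuclideanLin (∑ v, ((r v).re : ℂ) • ketbra (b v)) := by
      refine b.toBasis.ext fun w => ?_
      rw [b.coe_toBasis]
      apply WithLp.ofLp_injective 2
      change ρ.mulVec (b w).ofLp = (∑ v, ((r v).re : ℂ) • ketbra (b v)).mulVec (b w).ofLp
      rw [hr, Matrix.sum_mulVec, Finset.sum_eq_single w]
      · rw [Matrix.smul_mulVec, ketbra_mulVec, hnorm, one_smul, hre]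
      · intro v _ hvw
        have h2 : inner ℂ (b v) (b w) = 0 := b.orthonormal.2 hvw
        rw [EuclideanSpace.inner_eq_star_dotProduct, dotProduct_comm] at h2
        rw [Matrix.smul_mulVec, ketbra_mulVec, h2, zero_smul, smul_zero]
      · simp
    exact Matrix.toEuclideanLin.injective h1
  refine ⟨b, lam, fun v => (r v).re, hw, fun v => (Complex.le_def.1 (hr0 v)).1, ?_, hsum⟩
  have h1 := htr
  rw [hsum, Matrix.trace_sum] at h1
  simp only [Matrix.trace_smul, trace_ketbra (b.orthonormal.1 _), smul_eq_mul, mul_one] at h1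
  exact_mod_cast h1

theorem HasWeight.trace_ketbra_mul {lam : Module.Dual ℝ (iCartan h)} {v : EuclideanSpace ℂ n}
    (hv : HasWeight h lam v) (hv1 : ‖v‖ = 1) (H : iCartan h) :
    (ketbra v * (H : Matrix n n ℂ)).trace = ((lam H : ℝ) : ℂ) := by
  rw [BarrenPlateau.trace_ketbra_mul, hv H, dotProduct_smul,
    star_dotProduct_self_of_norm_eq_one hv1, smul_eq_mul, mul_one]

theorem IsWeightDecomposition.trace_mul {ρ : Matrix n n ℂ}
    {b : OrthonormalBasis n ℂ (EuclideanSpace ℂ n)}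
    {lam : n → Module.Dual ℝ (iCartan h)} {r : n → ℝ} (hρ : IsWeightDecomposition h ρ b lam r)
    (H : iCartan h) : (ρ * (H : Matrix n n ℂ)).trace.re = (∑ v, r v • lam v) H := by
  rw [hρ.eq_sum, Finset.sum_mul, Matrix.trace_sum, Complex.re_sum, LinearMap.sum_apply]
  refine Finset.sum_congr rfl fun v _ => ?_
  rw [smul_mul_assoc, Matrix.trace_smul, (hρ.weight v).trace_ketbra_mul (b.orthonormal.1 v),
    LinearMap.smul_apply, smul_eq_mul, smul_eq_mul, ← Complex.ofReal_mul, Complex.ofReal_re]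

theorem eq_zero_of_trace_mul_eq_zero (hg : IsSkewHermitianAlgebra g) {D : Matrix n n ℂ}
    (hD : D ∈ iMul g.toSubmodule) (h0 : (D * D).trace.re = 0) : D = 0 := by
  refine eq_zero_of_trace_conjTranspose_mul_self_re ?_
  rwa [isHermitian_of_mem_iMul hg hD]

/-- The projection to `i𝔤` of a matrix that commutes with `𝔥` lies in `i𝔥`. -/
theorem projection_mem_iCartan (hg : IsSkewHermitianAlgebra g) (hh : h.IsCartanSubalgebra)
    {ρ : Matrix n n ℂ} (hc : ∀ H ∈ iCartan h, Commute ρ H) (p : iMul g.toSubmodule)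
    (hp : ∀ w : iMul g.toSubmodule,
      (ρ * (w : Matrix n n ℂ)).trace.re = ((p : Matrix n n ℂ) * (w : Matrix n n ℂ)).trace.re) :
    (p : Matrix n n ℂ) ∈ iCartan h := by
  refine mem_iCartan_of_commute hh p.2 fun H hH => ?_
  have hpH : (p : Matrix n n ℂ).IsHermitian := isHermitian_of_mem_iMul hg p.2
  have hHH : H.IsHermitian := isHermitian_of_mem_iMul hg (iCartan_le h hH)
  set D := (p : Matrix n n ℂ) * H - H * p with hD
  have hDs : (Complex.I • D).IsHermitian := by
    rw [Matrix.IsHermitian, Matrix.conjTranspose_smul, hD, Matrix.conjTranspose_sub,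
      Matrix.conjTranspose_mul, Matrix.conjTranspose_mul, hpH, hHH, Complex.star_def,
      Complex.conj_I, neg_smul, ← smul_neg, neg_sub]
  have hDg : Complex.I • D ∈ iMul g.toSubmodule := mem_iMul_of_isHermitian hg
    (Submodule.smul_mem _ _ (commutator_mem_complexSpan (mem_complexSpan_of_mem_iMul p.2)
      (mem_complexSpan_of_mem_iMul (iCartan_le h hH)))) hDs
  -- Invariance of the trace form. For `A = ρ` the right side vanishes, and for `A = p` it is
  -- `Tr[(iD)²]`; the defining property of `p` equates the real parts, so `D = 0`.
  have hF : ∀ A : Matrix n n ℂ,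
      (A * (Complex.I • (H * (Complex.I • D) - (Complex.I • D) * H))).trace =
        Complex.I * ((A * H - H * A) * (Complex.I • D)).trace := by
    intro A
    rw [mul_smul_comm, Matrix.trace_smul, smul_eq_mul, mul_sub, sub_mul, Matrix.trace_sub,
      Matrix.trace_sub, ← mul_assoc, ← mul_assoc, Matrix.trace_mul_comm (A * _) H, ← mul_assoc]
  have hFh : (Complex.I • (H * (Complex.I • D) - (Complex.I • D) * H)).IsHermitian := by
    rw [Matrix.IsHermitian, Matrix.conjTranspose_smul, Matrix.conjTranspose_sub,
      Matrix.conjTranspose_mul, Matrix.conjTranspose_mul, hDs, hHH, Complex.star_def,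
      Complex.conj_I, neg_smul, ← smul_neg, neg_sub]
  have hFg : Complex.I • (H * (Complex.I • D) - (Complex.I • D) * H) ∈ iMul g.toSubmodule :=
    mem_iMul_of_isHermitian hg
      (Submodule.smul_mem _ _ (commutator_mem_complexSpan
        (mem_complexSpan_of_mem_iMul (iCartan_le h hH)) (mem_complexSpan_of_mem_iMul hDg))) hFh
  have h1 := hp ⟨_, hFg⟩
  rw [hF, hF, (hc H hH).eq, sub_self, zero_mul, Matrix.trace_zero, mul_zero, Complex.zero_re,
    ← hD, ← smul_eq_mul, ← Matrix.trace_smul, ← smul_mul_assoc] at h1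
  have h2 := (smul_eq_zero.1 (eq_zero_of_trace_mul_eq_zero hg hDg h1.symm)).resolve_left
    Complex.I_ne_zero
  exact sub_eq_zero.1 h2

/-- The variance of a weight state, in terms of the functional `H ↦ Tr[ρ H]` on `i𝔥`. -/
theorem lossVariance_of_mem_weightStates (hg : IsSkewHermitianAlgebra g)
    (hsimple : LieAlgebra.IsSimple ℝ g) (hh : h.IsCartanSubalgebra) {Θ : Type*}
    [MeasurableSpace Θ] (P : Measure Θ) [IsProbabilityMeasure P] {U : Θ → Matrix.unitaryGroup n ℂ}
    (hU : ∀ i j, Measurable fun θ => (U θ : Matrix n n ℂ) i j) (hdes : IsDesign g P U 2)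
    {O : Matrix n n ℂ} (hO : O ∈ iMul g.toSubmodule) {ρ : Matrix n n ℂ}
    (hρ : ρ ∈ weightStates h) {d : ℕ} {B : Module.Basis (Fin d) ℝ (iCartan h)}
    (hB : IsHSOrthonormal B) {lam : Module.Dual ℝ (iCartan h)}
    (hlam : ∀ H : iCartan h, (ρ * (H : Matrix n n ℂ)).trace.re = lam H) :
    lossVariance P U ρ O =
      (O ^ 2).trace.re / (Module.finrank ℝ g : ℝ) * weightNormSq B lam := by
  obtain ⟨hpos, htr, hc⟩ := mem_weightStates_iff.1 hρ
  have hne : Nonempty n := by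
    by_contra hn
    rw [not_nonempty_iff] at hn
    simp [Matrix.trace] at htr
  obtain ⟨p, hp⟩ := exists_projection hg ρ
  have hpc := projection_mem_iCartan hg hh hc p hp
  have hpair : ∀ H : iCartan h, ((p : Matrix n n ℂ) * (H : Matrix n n ℂ)).trace.re = lam H :=
    fun H => by rw [← hlam, ← hp ⟨H, iCartan_le h H.2⟩]
  -- Both elements of `i𝔥` represent `lam` for the trace form, which is definite there.
  have hpd : (p : Matrix n n ℂ) = dualVec B lam := by
    let D : iCartan h := ⟨p, hpc⟩ - dualVec B lam
    refine sub_eq_zero.1 (eq_zero_of_trace_mul_eq_zero hg (iCartan_le h D.2) ?_)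
    change (((p : Matrix n n ℂ) - dualVec B lam) * (D : Matrix n n ℂ)).trace.re = 0
    rw [sub_mul, Matrix.trace_sub, Complex.sub_re, hpair, trace_dualVec_mul hg hB, sub_self]
  rw [lossVariance_eq_haarG P hU hdes hpos.isHermitian (isHermitian_of_mem_iMul hg hO),
    lossVariance_haarG hg hsimple ρ p hp ⟨O, hO⟩]
  nth_rw 2 [hpd]
  rw [hpair, apply_dualVec_self]

/-- Jensen's inequality for the square, in each coordinate. -/
theorem weightNormSq_sum_le {d : ℕ} (B : Module.Basis (Fin d) ℝ (iCartan h))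
    (lam : n → Module.Dual ℝ (iCartan h)) {r : n → ℝ} (hr : ∀ v, 0 ≤ r v) (hr1 : ∑ v, r v = 1)
    {M : ℝ} (hM : ∀ v, weightNormSq B (lam v) ≤ M) : weightNormSq B (∑ v, r v • lam v) ≤ M := by
  have h1 : weightNormSq B (∑ v, r v • lam v) ≤ ∑ v, r v * weightNormSq B (lam v) := by
    simp only [weightNormSq, Finset.mul_sum]
    rw [Finset.sum_comm]
    refine Finset.sum_le_sum fun j _ => ?_
    simp only [LinearMap.sum_apply, LinearMap.smul_apply, smul_eq_mul]
    exact (even_two.convexOn_pow (𝕜 := ℝ)).map_sum_le (fun v _ => hr v) hr1 (fun v _ => Set.mem_univ _)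
  refine h1.trans ((Finset.sum_le_sum fun v _ => mul_le_mul_of_nonneg_left (hM v) (hr v)).trans ?_)
  rw [← Finset.sum_mul, hr1, one_mul]

theorem exists_isHSOrthonormal (hg : IsSkewHermitianAlgebra g) (h : LieSubalgebra ℝ g) :
    ∃ (d : ℕ) (B : Module.Basis (Fin d) ℝ (iCartan h)), IsHSOrthonormal B := by
  obtain ⟨e, he, -⟩ := exists_orthonormal_basis (hsCoreReal (iCartan h))
  refine ⟨_, e, fun i j => ?_⟩
  have hH : ∀ i, (e i : Matrix n n ℂ).IsHermitian := fun i =>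
    isHermitian_of_mem_iMul hg (iCartan_le h (e i).2)
  have h1 : ((e i : Matrix n n ℂ).conjTranspose * (e j : Matrix n n ℂ)).trace.re =
      if i = j then 1 else 0 := he i j
  rw [(hH i).eq] at h1 ⊢
  rw [trace_mul_eq_ofReal (hH i) (hH j), h1]
  split_ifs <;> simp

end

end BarrenPlateau

/-! ### The theorem -/

theorem corollary2 {n : Type*} [Fintype n] [DecidableEq n]
    (g : LieSubalgebra ℝ (Matrix n n ℂ)) (hg : IsSkewHermitianAlgebra g)
    (hsimple : LieAlgebra.IsSimple ℝ g)
    (h : LieSubalgebra ℝ g) (hh : h.IsCartanSubalgebra)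
    {Θ : Type*} [MeasurableSpace Θ] (P : Measure Θ) (hP : IsProbabilityMeasure P)
    (U : Θ → Matrix.unitaryGroup n ℂ)
    (hUmeas : ∀ i j, Measurable fun θ => (U θ : Matrix n n ℂ) i j)
    (hU : IsDesign g P U 2)
    (O : Matrix n n ℂ) (hO : O ∈ iMul g.toSubmodule) :
    (∀ ρ : Matrix n n ℂ, ρ ∈ weightStates h ↔ ∃ b lam r, IsWeightDecomposition h ρ b lam r) ∧
    (∀ ρ b lam r, IsWeightDecomposition h ρ b lam r →
      ∀ (d : ℕ) (B : Module.Basis (Fin d) ℝ (iCartan h)), IsHSOrthonormal B →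
        lossVariance P U ρ O =
          (O ^ 2).trace.re / (Module.finrank ℝ g : ℝ) * weightNormSq B (∑ v, r v • lam v)) ∧
    (ActsIrreducibly g → ∀ H₀ : iCartan h, IsRegularElement H₀ →
      ∀ v : EuclideanSpace ℂ n, IsHighestWeightVector H₀ v →
        ketbra v ∈ weightStates h ∧
        IsMaxOn (fun ρ => lossVariance P U ρ O) (weightStates h) (ketbra v)) := by
  refine ⟨fun ρ => ⟨exists_isWeightDecomposition hg hh, ?_⟩, ?_, ?_⟩
  · rintro ⟨b, lam, r, hρ⟩
    exact hρ.mem_weightStates hg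
  · intro ρ b lam r hρ d B hB
    exact lossVariance_of_mem_weightStates hg hsimple hh P hUmeas hU hO (hρ.mem_weightStates hg) hB
      hρ.trace_mul
  · intro hirr H₀ hreg v hv
    obtain ⟨lam, hlam⟩ := hv.weight
    have hstate : ketbra v ∈ weightStates h := mem_weightStates_iff.2
      ⟨Matrix.posSemidef_vecMulVec_self_star _, trace_ketbra hv.norm_eq_one,
        fun H hH => hlam.commute_ketbra hg ⟨H, hH⟩⟩
    refine ⟨hstate, fun ρ hρ => ?_⟩
    -- The claim involves no basis of `i𝔥`; any orthonormal one serves to compare the two variances.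
    obtain ⟨d, B, hB⟩ := exists_isHSOrthonormal hg h
    obtain ⟨b, mu, r, hdec⟩ := exists_isWeightDecomposition hg hh hρ
    change lossVariance P U ρ O ≤ lossVariance P U (ketbra v) O
    rw [lossVariance_of_mem_weightStates hg hsimple hh P hUmeas hU hO hρ hB hdec.trace_mul,
      lossVariance_of_mem_weightStates hg hsimple hh P hUmeas hU hO hstate hB (lam := lam)
        fun H => by rw [hlam.trace_ketbra_mul hv.norm_eq_one, Complex.ofReal_re]]
    refine mul_le_mul_of_nonneg_left ?_ (div_nonneg ?_ (Nat.cast_nonneg _))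
    · exact weightNormSq_sum_le B mu hdec.nonneg hdec.sum_eq_one fun w =>
        weightNormSq_le_of_isHighestWeightVector hg hh hirr hB hreg hv hlam (hdec.weight w)
          (b.orthonormal.ne_zero w)
    · have h1 := trace_conjTranspose_mul_self_re_nonneg O
      rwa [isHermitian_of_mem_iMul hg hO, ← pow_two] at h1
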